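/- Let $D$ be a finite set with a distinguished element $0$, and let $\Gamma$ be a finite set of relations on $D$, each of finite arity. A relation is *$0$-valid* if it contains the all-zero tuple. $\Gamma$ is a *cc0-language* if every $R\in\Gamma$ is $0$-valid and every $0$-valid relation of positive arity obtained from some $R\in\Gamma$ by substituting constants from $D$ for some of its coordinates (that is, fixing these coordinates and projecting onto the remaining ones) also belongs to $\Gamma$. Two tuples $t_1,t_2\in D^r$ are *disjoint* if in each coordinate at least one of them is $0$; their union $t_1+t_2$ takes in each coordinate the value of $t_1$ if this is nonzero and the value of $t_2$ otherwise. $\Gamma$ is *weakly separable* if for every $R\in\Gamma$ and all disjoint tuples $t_1,t_2$: (1) $t_1,t_2\in R$ implies $t_1+t_2\in R$; (2) $t_2\in R$ and $t_1+t_2\in R$ imply $t_1\in R$. An instance of $\mathrm{CSP}(\Gamma)$ consists of a finite set $V$ of variables and a finite collection $\mathcal C$ of constraints $\langle s,R\rangle$ with $R\in\Gamma$ and $s$ a tuple of variables (repetitions allowed) whose length is the arity of $R$; an assignment $\tau:V\to D$ is satisfying if $\tau(s)\in R$ for all $\langle s,R\rangle\in\mathcal C$. In $\mathrm{OCSP}(\Gamma)$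 (CSP with a size constraint) the input is $(V,\mathcal C,k)$ with $k\in\mathbb N$, and the question is whether there is a satisfying assignment under which exactly $k$ variables have a nonzero value. In $\mathrm{CCSP}(\Gamma)$ (CSP with a cardinality constraint) the input is $(V,\mathcal C,k,\pi)$ with $k\in\mathbb N$ and $\pi:D\setminus\{0\}\to\mathbb N$, and the question is whether there is a satisfying assignment under which exactly $k$ variables have a nonzero value and, for every $a\in D\setminus\{0\}$, exactly $\pi(a)$ variables have the value $a$. In both problems the parameter is $k$. **Theorem.** If $\Gamma$ is a finite weakly separable cc0-language over $D$, then both $\mathrm{CCSP}(\Gamma)$ and $\mathrm{OCSP}(\Gamma)$ are fixed-parameter tractable with respect to $k$. That is, for each of the two problems there are a computable function $f$, a constant $c$ and an algorithm that decides every instance in at most $f(k)\cdot(n+1)^{c}$ steps, where $n$ is $|V|$ plus the total length of the constraints (a constraint of arity $r$ having length $r+1$). Here algorithms are programs on binary trees that produce `nil`, take heads and tails, allocate cells, test for `nil`, and are composed by sequencing, branching and while-loops, at unit cost per step (a model that is polynomially equivalent to Turing machines). -/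

import Mathlib

namespace SizeCSP

/-! ### Constraint languages -/

/-- A relation on `D` of some finite arity. -/
structure Rel (D : Type*) where
  arity : ℕ
  tuples : Set (Fin arity → D)

/-- The relation contains the all-zero tuple. -/
def Rel.ZeroValid {D : Type*} [Zero D] (R : Rel D) : Prop :=
  (fun _ => 0) ∈ R.tuples

/-- The relation obtained from `R` by keeping the coordinates in the range of `j`, in their
original order, and substituting the constant `c i` for every other coordinate `i`. -/
def Rel.substConst {D : Type*} (R : Rel D) {m : ℕ} (j : Fin m ↪o Fin R.arity)
    (c : Fin R.arity → D) : Rel D where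
  arity := m
  tuples := {t | ∃ s ∈ R.tuples, (∀ l, s (j l) = t l) ∧ ∀ i, i ∉ Set.range j → s i = c i}

/-- A cc0-language: every relation is 0-valid, and every 0-valid relation (of positive arity)
obtained from a relation of the language by substituting constants is in the language. -/
def IsCC0Language {D : Type*} [Zero D] (Γ : Set (Rel D)) : Prop :=
  (∀ R ∈ Γ, R.ZeroValid) ∧
  ∀ R ∈ Γ, ∀ (m : ℕ), 0 < m → ∀ (j : Fin m ↪o Fin R.arity) (c : Fin R.arity → D),
    (R.substConst j c).ZeroValid → R.substConst j c ∈ Γ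

/-- Two tuples are disjoint if no coordinate is nonzero in both. -/
def DisjointTuples {D : Type*} [Zero D] {r : ℕ} (s t : Fin r → D) : Prop :=
  ∀ i, s i = 0 ∨ t i = 0

open Classical in
/-- The union `s + t` of two (disjoint) tuples. -/
noncomputable def unionTuple {D : Type*} [Zero D] {r : ℕ} (s t : Fin r → D) : Fin r → D :=
  fun i => if s i ≠ 0 then s i else t i

/-- Weak separability of a (0-valid) relation. -/
def Rel.WeaklySeparable {D : Type*} [Zero D] (R : Rel D) : Prop :=
  (∀ s t, DisjointTuples s t → s ∈ R.tuples → t ∈ R.tuples → unionTuple s t ∈ R.tuples) ∧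
  (∀ s t, DisjointTuples s t → t ∈ R.tuples → unionTuple s t ∈ R.tuples → s ∈ R.tuples)

/-- A language is weakly separable if each of its relations is. -/
def WeaklySeparable {D : Type*} [Zero D] (Γ : Set (Rel D)) : Prop :=
  ∀ R ∈ Γ, R.WeaklySeparable

/-! ### Instances and solutions -/

/-- A constraint over `Γ` on the variables `0, …, n - 1`; repeated variables are allowed. -/
structure Constraint {D : Type*} (Γ : Set (Rel D)) (n : ℕ) where
  rel : Γ
  scope : Fin rel.1.arity → Fin n

/-- An instance `(V, C)` of `CSP(Γ)`, with `V = {0, …, numVars - 1}`. -/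
structure Instance {D : Type*} (Γ : Set (Rel D)) where
  numVars : ℕ
  constraints : List (Constraint Γ numVars)

/-- `τ` is a satisfying assignment of `I`. -/
def Instance.Satisfies {D : Type*} {Γ : Set (Rel D)} (I : Instance Γ)
    (τ : Fin I.numVars → D) : Prop :=
  ∀ C ∈ I.constraints, (fun i => τ (C.scope i)) ∈ C.rel.1.tuples

/-- The size of an instance: the number of variables plus the total length of the
constraints, a constraint of arity `r` having length `r + 1`. -/
def Instance.size {D : Type*} {Γ : Set (Rel D)} (I : Instance Γ) : ℕ :=
  I.numVars + (I.constraints.map fun C => C.rel.1.arity + 1).sum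

/-- The size of an assignment: the number of variables with a nonzero value. -/
noncomputable def assignmentSize {D : Type*} [Zero D] {n : ℕ} (τ : Fin n → D) : ℕ :=
  {v | τ v ≠ 0}.ncard

/-- An instance `(V, C, k)` of the CSP with a size constraint. -/
structure OCSPInstance {D : Type*} (Γ : Set (Rel D)) extends Instance Γ where
  k : ℕ

/-- There is a satisfying assignment of size exactly `k`. -/
def OCSPInstance.HasSolution {D : Type*} [Zero D] {Γ : Set (Rel D)}
    (I : OCSPInstance Γ) : Prop :=
  ∃ τ : Fin I.numVars → D, I.Satisfies τ ∧ assignmentSize τ = I.k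

/-- An instance `(V, C, k, π)` of the CSP with a cardinality constraint. -/
structure CCSPInstance {D : Type*} [Zero D] (Γ : Set (Rel D)) extends Instance Γ where
  k : ℕ
  card : {a : D // a ≠ 0} → ℕ

/-- There is a satisfying assignment of size exactly `k` that takes each nonzero value `a`
exactly `π a` times. -/
def CCSPInstance.HasSolution {D : Type*} [Zero D] {Γ : Set (Rel D)}
    (I : CCSPInstance Γ) : Prop :=
  ∃ τ : Fin I.numVars → D, I.Satisfies τ ∧ assignmentSize τ = I.k ∧
    ∀ a : {a : D // a ≠ 0}, {v | τ v = a.1}.ncard = I.card a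

/-! ### The machine model: programs on binary trees (list structures) with unit-cost steps

The data are binary trees held in a pointer structure, as in pure Lisp. Each elementary
operation (produce `nil`, take the head, take the tail, allocate one new cell, test for `nil`,
pass control) costs one step. Trees can be compared with `nil` only, so that `t` steps create
at most `t` new cells and are simulated by a Turing machine in time polynomial in `t` and the
size of the input. -/

/-- The data: binary trees. -/
inductive Data where
  | nil : Data
  | cons (a b : Data) : Data

/-- The head (left subtree) of a tree. -/
def Data.hd : Data → Data
  | .nil => .nil
  | .cons a _ => a

/-- The tail (right subtree) of a tree. -/
def Data.tl : Data → Data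
  | .nil => .nil
  | .cons _ b => b

/-- Programs; each of them computes a partial function from trees to trees. -/
inductive Prog where
  /-- return the input -/
  | skip : Prog
  /-- return `nil` -/
  | nil : Prog
  /-- return the head of the input -/
  | hd : Prog
  /-- return the tail of the input -/
  | tl : Prog
  /-- run `p` and `q` on the input and return a new cell with the two results -/
  | cons (p q : Prog) : Prog
  /-- run `p`, then run `q` on the result -/
  | seq (p q : Prog) : Prog
  /-- if `c` returns a non-`nil` value on the input then run `p` on the input, else `q` -/
  | cond (c p q : Prog) : Prog
  /-- while `c` returns a non-`nil` value on the current value, replace that value by the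
  result of `p` on it; then return the current value -/
  | loop (c p : Prog) : Prog

/-- `Runs p x y t`: on input `x` the program `p` halts with output `y` after exactly
`t` steps. -/
inductive Runs : Prog → Data → Data → ℕ → Prop where
  | skip (x : Data) : Runs .skip x x 1
  | nil (x : Data) : Runs .nil x .nil 1
  | hd (x : Data) : Runs .hd x x.hd 1
  | tl (x : Data) : Runs .tl x x.tl 1
  | cons {p q : Prog} {x y z : Data} {s t : ℕ} :
      Runs p x y s → Runs q x z t → Runs (.cons p q) x (.cons y z) (s + t + 1)
  | seq {p q : Prog} {x y z : Data} {s t : ℕ} :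
      Runs p x y s → Runs q y z t → Runs (.seq p q) x z (s + t + 1)
  | condTrue {c p q : Prog} {x a b y : Data} {s t : ℕ} :
      Runs c x (.cons a b) s → Runs p x y t → Runs (.cond c p q) x y (s + t + 1)
  | condFalse {c p q : Prog} {x y : Data} {s t : ℕ} :
      Runs c x .nil s → Runs q x y t → Runs (.cond c p q) x y (s + t + 1)
  | loopStop {c p : Prog} {x : Data} {s : ℕ} :
      Runs c x .nil s → Runs (.loop c p) x x (s + 1)
  | loopStep {c p : Prog} {x a b y z : Data} {s t u : ℕ} :
      Runs c x (.cons a b) s → Runs p x y t → Runs (.loop c p) y z u →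
      Runs (.loop c p) x z (s + t + u + 1)

/-- Programs are deterministic: the output and the number of steps are determined by the
program and the input. -/
theorem Runs.deterministic {p : Prog} {x y y' : Data} {t t' : ℕ}
    (h : Runs p x y t) (h' : Runs p x y' t') : y = y' ∧ t = t' := by
  induction h generalizing y' t' with
  | skip x => cases h'; exact ⟨rfl, rfl⟩
  | nil x => cases h'; exact ⟨rfl, rfl⟩
  | hd x => cases h'; exact ⟨rfl, rfl⟩
  | tl x => cases h'; exact ⟨rfl, rfl⟩
  | cons _ _ ih1 ih2 =>
    cases h' with
    | cons h1 h2 =>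
      obtain ⟨rfl, rfl⟩ := ih1 h1
      obtain ⟨rfl, rfl⟩ := ih2 h2
      exact ⟨rfl, rfl⟩
  | seq _ _ ih1 ih2 =>
    cases h' with
    | seq h1 h2 =>
      obtain ⟨rfl, rfl⟩ := ih1 h1
      obtain ⟨rfl, rfl⟩ := ih2 h2
      exact ⟨rfl, rfl⟩
  | condTrue _ _ ih1 ih2 =>
    cases h' with
    | condTrue h1 h2 =>
      obtain ⟨-, rfl⟩ := ih1 h1
      obtain ⟨rfl, rfl⟩ := ih2 h2
      exact ⟨rfl, rfl⟩
    | condFalse h1 h2 => exact absurd (ih1 h1).1 (by simp)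
  | condFalse _ _ ih1 ih2 =>
    cases h' with
    | condTrue h1 h2 => exact absurd (ih1 h1).1 (by simp)
    | condFalse h1 h2 =>
      obtain ⟨-, rfl⟩ := ih1 h1
      obtain ⟨rfl, rfl⟩ := ih2 h2
      exact ⟨rfl, rfl⟩
  | loopStop _ ih1 =>
    cases h' with
    | loopStop h1 =>
      obtain ⟨-, rfl⟩ := ih1 h1
      exact ⟨rfl, rfl⟩
    | loopStep h1 h2 h3 => exact absurd (ih1 h1).1 (by simp)
  | loopStep _ _ _ ih1 ih2 ih3 =>
    cases h' with
    | loopStop h1 => exact absurd (ih1 h1).1 (by simp)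
    | loopStep h1 h2 h3 =>
      obtain ⟨-, rfl⟩ := ih1 h1
      obtain ⟨rfl, rfl⟩ := ih2 h2
      obtain ⟨rfl, rfl⟩ := ih3 h3
      exact ⟨rfl, rfl⟩

/-! ### Parameterized problems and fixed-parameter tractability -/

/-- A parameterized decision problem, with the encoding by which its instances are given to
a program. -/
structure ParamProblem where
  Inst : Type*
  encode : Inst → Data
  size : Inst → ℕ
  param : Inst → ℕ
  Yes : Inst → Prop

/-- `P` is fixed-parameter tractable: some program decides every instance (a non-`nil` output
means yes) in at most `f (k) * (n + 1) ^ c` steps, where `n` is the size and `k` the parameter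
of the instance, `f` is a computable function and `c` a constant. -/
def ParamProblem.IsFPT (P : ParamProblem) : Prop :=
  ∃ (p : Prog) (f : ℕ → ℕ) (c : ℕ), Computable f ∧
    ∀ I : P.Inst, ∃ (y : Data) (t : ℕ), Runs p (P.encode I) y t ∧
      t ≤ f (P.param I) * (P.size I + 1) ^ c ∧ (y ≠ .nil ↔ P.Yes I)

/-! ### The two problems -/

/-- The list with the given entries. -/
def Data.ofList : List Data → Data
  | [] => .nil
  | a :: l => .cons a (Data.ofList l)

/-- A natural number, as a list of `n` copies of `nil`. -/
def Data.ofNat (n : ℕ) : Data :=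
  Data.ofList (List.replicate n .nil)

/-- A constraint is given by the code of its relation and the list of its variables. -/
def Constraint.encode {D : Type*} {Γ : Set (Rel D)} (relCode : Γ → ℕ) {n : ℕ}
    (C : Constraint Γ n) : Data :=
  .cons (.ofNat (relCode C.rel)) (.ofList (List.ofFn fun i => .ofNat (C.scope i)))

/-- An instance is given by the number of its variables and the list of its constraints. -/
def Instance.encode {D : Type*} {Γ : Set (Rel D)} (relCode : Γ → ℕ) (I : Instance Γ) : Data :=
  .cons (.ofNat I.numVars) (.ofList (I.constraints.map (Constraint.encode relCode)))

/-- The CSP over `Γ` with size constraints, parameterized by `k`; the relations of `Γ` are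
named by the numbers `relCode`. The size of an instance does not count `k`. -/
def OCSP {D : Type*} [Zero D] (Γ : Set (Rel D)) (relCode : Γ → ℕ) : ParamProblem where
  Inst := OCSPInstance Γ
  encode I := .cons (I.toInstance.encode relCode) (.ofNat I.k)
  size I := I.toInstance.size
  param I := I.k
  Yes I := I.HasSolution

/-- The CSP over `Γ` with cardinality constraints, parameterized by `k`; the relations of `Γ`
are named by the numbers `relCode`, and `π` is given by the list of its values in the order
`valEnum` of the nonzero elements. The size of an instance does not count `k` and `π`. -/
def CCSP {D : Type*} [Zero D] (Γ : Set (Rel D)) (relCode : Γ → ℕ)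
    {d : ℕ} (valEnum : Fin d ≃ {a : D // a ≠ 0}) : ParamProblem where
  Inst := CCSPInstance Γ
  encode I := .cons (I.toInstance.encode relCode)
    (.cons (.ofNat I.k) (.ofList (List.ofFn fun i => .ofNat (I.card (valEnum i)))))
  size I := I.toInstance.size
  param I := I.k
  Yes I := I.HasSolution

end SizeCSP

namespace SizeCSP

/-! Write values as numbers `0, …, d` and assignments as functions that vanish from `n` on, so that
the union of disjoint assignments is their sum. Weak separability then says that disjoint solutions
can be added, and that a solution can be subtracted from a solution containing it (`IsSol.add`,
`IsSol.sub`). Hence every nonzero solution is the disjoint sum of a minimal nonzero solution and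
another solution (`IsSol.exists_isMinSol`).

The list of nonzero values in use, the type, is guessed; there are at most `(d + 1) ^ k` types of
length at most `k`. Variables then receive these values one at a time. If the partial assignment `S`
violates a constraint, every completion gives a value to a further variable in its scope, so there
are boundedly many branches. The difficult case is that `S` is already a solution while values
remain. The rest of the target is then a solution `m + h'` with `m` minimal, and the algorithm
branches on a fixed set of hubs whose size depends on `k` only. For each type, the hubs meet every
minimal solution of this type or contain `k + 1` disjoint solutions of it (`hitOrPacked_hubs`). In
the first case they meet `m`. In the second case one of these solutions, `g`, is disjoint from the
whole target, whose support has at most `k` elements; then `S + g + h'` is a target with the same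
values, and it uses a hub outside `S` (`exists_mem_expand_hubs`).

The hubs are collected greedily: for each type, a solution avoiding the earlier hubs is sought `k +
1` times. If a minimal one exists the search succeeds: once a first variable is guessed, each proper
nonzero part of a minimal solution violates a constraint, so branching on scopes suffices
(`greedyStep_spec`).

Running times come from a calculus of functions computable within `F (k) * (n + 1) ^ c` steps
(`Fpt`), closed under composition, pairing and loops over lists (`Fpt.foldl`). The decisive
estimates are `FptCSP.search` for the search tree and `FptCSP.hubs` for the number of hubs. -/

/-! ### Encodings -/

/-- Types whose elements are represented by trees. -/
class Enc (α : Type*) where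
  enc : α → Data
  inj : Function.Injective enc

open Enc

theorem Data.ofList_injective : Function.Injective Data.ofList := by
  intro l l' h
  induction l generalizing l' with
  | nil => cases l' with
    | nil => rfl
    | cons b l' => simp [Data.ofList] at h
  | cons a l ih => cases l' with
    | nil => simp [Data.ofList] at h
    | cons b l' =>
      simp only [Data.ofList, Data.cons.injEq] at h
      rw [h.1, ih h.2]

instance : Enc Unit := ⟨fun _ => .nil, fun _ _ _ => rfl⟩

instance : Enc Bool := ⟨fun b => if b then .cons .nil .nil else .nil, by
  intro a b h; cases a <;> cases b <;> simp_all⟩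

instance : Enc ℕ := ⟨Data.ofNat, by
  intro a b h
  simpa using congrArg List.length (Data.ofList_injective h)⟩

instance {α β : Type*} [Enc α] [Enc β] : Enc (α × β) :=
  ⟨fun x => .cons (enc x.1) (enc x.2), by
    rintro ⟨a, b⟩ ⟨a', b'⟩ h
    simp only [Data.cons.injEq] at h
    rw [inj h.1, inj h.2]⟩

instance {α : Type*} [Enc α] : Enc (List α) :=
  ⟨fun l => .ofList (l.map enc), fun _ _ h =>
    List.map_injective_iff.2 inj (Data.ofList_injective h)⟩

theorem enc_succ (n : ℕ) : enc (n + 1) = .cons .nil (enc n) := by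
  simp [enc, Data.ofNat, List.replicate_succ, Data.ofList]

/-- A number and a list of that many units are the same tree, so loops over lists also serve as
counting loops. -/
theorem enc_replicate_unit (n : ℕ) : enc (List.replicate n ()) = enc n := by
  simp [enc, Data.ofNat]

/-! ### Bounds in terms of the parameter and the size -/

variable {J J' : Type*} {μ : J → ℕ × ℕ}

/-- `T` is bounded by a function of the parameter times a polynomial of the size, where
`μ j` consists of the parameter and the size at `j`. -/
def Bd (μ : J → ℕ × ℕ) (T : J → ℕ) : Prop :=
  ∃ (F : ℕ → ℕ) (c : ℕ), Primrec F ∧ ∀ j, T j ≤ F (μ j).1 * ((μ j).2 + 1) ^ c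

/-- `T` is bounded by a function of the parameter. -/
def BdK (μ : J → ℕ × ℕ) (T : J → ℕ) : Prop :=
  ∃ F : ℕ → ℕ, Primrec F ∧ ∀ j, T j ≤ F (μ j).1

theorem Bd.mono {T U : J → ℕ} (h : Bd μ T) (hU : ∀ j, U j ≤ T j) : Bd μ U := by
  obtain ⟨F, c, hF, h⟩ := h
  exact ⟨F, c, hF, fun j => (hU j).trans (h j)⟩

theorem BdK.mono {T U : J → ℕ} (h : BdK μ T) (hU : ∀ j, U j ≤ T j) : BdK μ U := by
  obtain ⟨F, hF, h⟩ := h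
  exact ⟨F, hF, fun j => (hU j).trans (h j)⟩

theorem Bd.reindex {T : J → ℕ} (h : Bd μ T) (φ : J' → J) :
    Bd (fun x => μ (φ x)) (fun x => T (φ x)) := by
  obtain ⟨F, c, hF, h⟩ := h
  exact ⟨F, c, hF, fun j => h _⟩

theorem BdK.reindex {T : J → ℕ} (h : BdK μ T) (φ : J' → J) :
    BdK (fun x => μ (φ x)) (fun x => T (φ x)) := by
  obtain ⟨F, hF, h⟩ := h
  exact ⟨F, hF, fun j => h _⟩

theorem BdK.bd {T : J → ℕ} (h : BdK μ T) : Bd μ T := by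
  obtain ⟨F, hF, h⟩ := h
  exact ⟨F, 0, hF, fun j => by simpa using h j⟩

theorem BdK.const (c : ℕ) : BdK μ (fun _ => c) := ⟨fun _ => c, Primrec.const c, fun _ => le_rfl⟩

theorem Bd.const (c : ℕ) : Bd μ (fun _ => c) := (BdK.const c).bd

theorem BdK.param : BdK μ (fun j => (μ j).1) := ⟨id, Primrec.id, fun _ => le_rfl⟩

theorem Bd.size : Bd μ (fun j => (μ j).2) :=
  ⟨fun _ => 1, 1, Primrec.const 1, fun j => by simp⟩

theorem BdK.add {T U : J → ℕ} (h : BdK μ T) (h' : BdK μ U) : BdK μ (fun j => T j + U j) := by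
  obtain ⟨F, hF, h⟩ := h
  obtain ⟨G, hG, h'⟩ := h'
  exact ⟨fun k => F k + G k, Primrec.nat_add.comp hF hG, fun j => add_le_add (h j) (h' j)⟩

theorem BdK.mul {T U : J → ℕ} (h : BdK μ T) (h' : BdK μ U) : BdK μ (fun j => T j * U j) := by
  obtain ⟨F, hF, h⟩ := h
  obtain ⟨G, hG, h'⟩ := h'
  exact ⟨fun k => F k * G k, Primrec.nat_mul.comp hF hG, fun j => Nat.mul_le_mul (h j) (h' j)⟩

/-- The base is positive because of the `+ 1`, which makes the power monotone in the exponent. -/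
theorem BdK.pow {T U : J → ℕ} (h : BdK μ T) (h' : BdK μ U) :
    BdK μ (fun j => (T j + 1) ^ U j) := by
  obtain ⟨F, hF, h⟩ := h
  obtain ⟨G, hG, h'⟩ := h'
  exact ⟨fun k => (F k + 1) ^ G k,
    (Primrec₂.unpaired'.1 Nat.Primrec.pow).comp (Primrec.succ.comp hF) hG, fun j =>
    (Nat.pow_le_pow_left (Nat.succ_le_succ (h j)) _).trans
      (Nat.pow_le_pow_right (Nat.succ_pos _) (h' j))⟩

theorem Bd.mul {T U : J → ℕ} (h : Bd μ T) (h' : Bd μ U) : Bd μ (fun j => T j * U j) := by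
  obtain ⟨F, c, hF, h⟩ := h
  obtain ⟨G, d, hG, h'⟩ := h'
  refine ⟨fun k => F k * G k, c + d, Primrec.nat_mul.comp hF hG, fun j => ?_⟩
  calc T j * U j ≤ _ := Nat.mul_le_mul (h j) (h' j)
    _ = _ := by ring

theorem Bd.add {T U : J → ℕ} (h : Bd μ T) (h' : Bd μ U) : Bd μ (fun j => T j + U j) := by
  obtain ⟨F, c, hF, h⟩ := h
  obtain ⟨G, d, hG, h'⟩ := h'
  refine ⟨fun k => F k + G k, c + d, Primrec.nat_add.comp hF hG, fun j => ?_⟩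
  have h1 : ((μ j).2 + 1) ^ c ≤ ((μ j).2 + 1) ^ (c + d) :=
    Nat.pow_le_pow_right (Nat.succ_pos _) (Nat.le_add_right _ _)
  have h2 : ((μ j).2 + 1) ^ d ≤ ((μ j).2 + 1) ^ (c + d) :=
    Nat.pow_le_pow_right (Nat.succ_pos _) (Nat.le_add_left _ _)
  calc T j + U j ≤ _ := add_le_add (h j) (h' j)
    _ ≤ F (μ j).1 * ((μ j).2 + 1) ^ (c + d) + G (μ j).1 * ((μ j).2 + 1) ^ (c + d) :=
      add_le_add (Nat.mul_le_mul_left _ h1) (Nat.mul_le_mul_left _ h2)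
    _ = _ := by ring

/-! ### Functions computable within such bounds -/

variable {ε α β σ : Type*} [Enc ε] [Enc α] [Enc β] [Enc σ]

/-- Some program computes `f j` from `e j`, for all `j`, within a time bound in terms of `μ j`. -/
def Fpt (μ : J → ℕ × ℕ) (e : J → ε) (f : J → α) : Prop :=
  ∃ (p : Prog) (F : ℕ → ℕ) (c : ℕ), Primrec F ∧
    ∀ j, ∃ t ≤ F (μ j).1 * ((μ j).2 + 1) ^ c, Runs p (enc (e j)) (enc (f j)) t

variable {e : J → ε} {f : J → α} {g : J → β}

/-! ### Closure properties and elementary operations. -/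

theorem Fpt.of_bd {T : J → ℕ} (p : Prog) (hT : Bd μ T)
    (h : ∀ j, ∃ t ≤ T j, Runs p (enc (e j)) (enc (f j)) t) : Fpt μ e f := by
  obtain ⟨F, c, hF, hT⟩ := hT
  refine ⟨p, F, c, hF, fun j => ?_⟩
  obtain ⟨t, ht, hr⟩ := h j
  exact ⟨t, ht.trans (hT j), hr⟩

theorem Fpt.exists_bd (h : Fpt μ e f) : ∃ (p : Prog) (B : ℕ × ℕ → ℕ), Bd μ (fun j => B (μ j)) ∧
    ∀ j, ∃ t ≤ B (μ j), Runs p (enc (e j)) (enc (f j)) t := by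
  obtain ⟨p, F, c, hF, h⟩ := h
  exact ⟨p, fun x => F x.1 * (x.2 + 1) ^ c, ⟨F, c, hF, fun _ => le_rfl⟩, h⟩

/-- Programs see only trees, so a result can be reread at no cost in another type with the same
encoding: a pair as a nonempty list, a number as a list of units. -/
theorem Fpt.congr (h : Fpt μ e f) {f' : J → β} (hf : ∀ j, enc (f' j) = enc (f j)) :
    Fpt μ e f' := by
  obtain ⟨p, F, c, hF, h⟩ := h
  exact ⟨p, F, c, hF, fun j => by rw [hf]; exact h j⟩

theorem Fpt.of_eq (h : Fpt μ e f) {f' : J → α} (hf : ∀ j, f' j = f j) : Fpt μ e f' :=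
  h.congr fun j => by rw [hf]

theorem Fpt.reindex (h : Fpt μ e f) (φ : J' → J) :
    Fpt (fun x => μ (φ x)) (fun x => e (φ x)) (fun x => f (φ x)) := by
  obtain ⟨p, F, c, hF, h⟩ := h
  exact ⟨p, F, c, hF, fun j => h _⟩

theorem Fpt.id : Fpt μ e e :=
  .of_bd .skip (Bd.const 1) fun _ => ⟨1, le_rfl, .skip _⟩

theorem Fpt.comp (h : Fpt μ e f) (h' : Fpt μ f g) : Fpt μ e g := by
  obtain ⟨p, A, hA, h⟩ := h.exists_bd
  obtain ⟨q, B, hB, h'⟩ := h'.exists_bd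
  refine .of_bd (.seq p q) ((hA.add hB).add (Bd.const 1)) fun j => ?_
  obtain ⟨s, hs, hr⟩ := h j
  obtain ⟨t, ht, hr'⟩ := h' j
  exact ⟨_, by gcongr, .seq hr hr'⟩

theorem Fpt.pair (h : Fpt μ e f) (h' : Fpt μ e g) : Fpt μ e (fun j => (f j, g j)) := by
  obtain ⟨p, A, hA, h⟩ := h.exists_bd
  obtain ⟨q, B, hB, h'⟩ := h'.exists_bd
  refine .of_bd (.cons p q) ((hA.add hB).add (Bd.const 1)) fun j => ?_
  obtain ⟨s, hs, hr⟩ := h j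
  obtain ⟨t, ht, hr'⟩ := h' j
  exact ⟨_, by gcongr, .cons hr hr'⟩

theorem Fpt.fst {f : J → α × β} (h : Fpt μ e f) : Fpt μ e (fun j => (f j).1) :=
  h.comp (.of_bd .hd (Bd.const 1) fun _ => ⟨1, le_rfl, .hd _⟩)

theorem Fpt.snd {f : J → α × β} (h : Fpt μ e f) : Fpt μ e (fun j => (f j).2) :=
  h.comp (.of_bd .tl (Bd.const 1) fun _ => ⟨1, le_rfl, .tl _⟩)

/-- The program that returns the constant `c`. -/
def Prog.const : Data → Prog
  | .nil => .nil
  | .cons a b => .cons (Prog.const a) (Prog.const b)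

theorem Prog.exists_runs_const (c : Data) : ∃ t, ∀ x, Runs (Prog.const c) x c t := by
  induction c with
  | nil => exact ⟨1, fun x => .nil x⟩
  | cons a b iha ihb =>
    obtain ⟨s, hs⟩ := iha
    obtain ⟨t, ht⟩ := ihb
    exact ⟨_, fun x => .cons (hs x) (ht x)⟩

theorem Fpt.const (a : α) : Fpt μ e (fun _ => a) := by
  obtain ⟨t, ht⟩ := Prog.exists_runs_const (enc a)
  exact .of_bd _ (Bd.const t) fun _ => ⟨t, le_rfl, ht _⟩

theorem Fpt.ite {b : J → Bool} {f g : J → α} (hb : Fpt μ e b) (hf : Fpt μ e f)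
    (hg : Fpt μ e g) : Fpt μ e (fun j => if b j then f j else g j) := by
  obtain ⟨r, C, hC, h⟩ := hb.exists_bd
  obtain ⟨p, A, hA, h'⟩ := hf.exists_bd
  obtain ⟨q, B, hB, h''⟩ := hg.exists_bd
  refine .of_bd (.cond r p q) (((hC.add hA).add hB).add (Bd.const 1)) fun j => ?_
  obtain ⟨s, hs, hr⟩ := h j
  obtain ⟨t, ht, hr'⟩ := h' j
  obtain ⟨u, hu, hr''⟩ := h'' j
  cases hbj : b j with
  | true =>
    rw [hbj] at hr
    exact ⟨_, by omega, .condTrue hr hr'⟩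
  | false =>
    rw [hbj] at hr
    exact ⟨_, by omega, .condFalse hr hr''⟩

theorem Fpt.not {b : J → Bool} (hb : Fpt μ e b) : Fpt μ e (fun j => !b j) :=
  (hb.ite (.const false) (.const true)).of_eq fun j => by cases b j <;> rfl

theorem Fpt.and {b c : J → Bool} (hb : Fpt μ e b) (hc : Fpt μ e c) :
    Fpt μ e (fun j => b j && c j) :=
  (hb.ite hc (.const false)).of_eq fun j => by cases b j <;> rfl

theorem Fpt.or {b c : J → Bool} (hb : Fpt μ e b) (hc : Fpt μ e c) :
    Fpt μ e (fun j => b j || c j) :=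
  (hb.ite (.const true) hc).of_eq fun j => by cases b j <;> rfl

theorem Fpt.cons {l : J → List α} (h : Fpt μ e f) (h' : Fpt μ e l) :
    Fpt μ e (fun j => f j :: l j) :=
  (h.pair h').congr fun _ => rfl

theorem Fpt.tail {l : J → List α} (h : Fpt μ e l) : Fpt μ e (fun j => (l j).tail) :=
  h.comp (.of_bd .tl (Bd.const 1) fun j => ⟨1, le_rfl, by
    have := Runs.tl (enc (l j))
    revert this
    cases l j <;> exact fun h => h⟩)

theorem Fpt.succ {m : J → ℕ} (h : Fpt μ e m) : Fpt μ e (fun j => m j + 1) :=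
  ((Fpt.const ()).pair h).congr fun _ => enc_succ _

theorem Fpt.units {m : J → ℕ} (h : Fpt μ e m) : Fpt μ e (fun j => List.replicate (m j) ()) :=
  h.congr fun _ => enc_replicate_unit _

theorem Fpt.pred {m : J → ℕ} (h : Fpt μ e m) : Fpt μ e (fun j => m j - 1) :=
  h.units.tail.congr fun _ => by rw [List.tail_replicate, enc_replicate_unit]

theorem Fpt.eq_zero {m : J → ℕ} (h : Fpt μ e m) : Fpt μ e (fun j => decide (m j = 0)) :=
  h.comp (.of_bd (.cond .skip .nil (.cons .nil .nil)) (Bd.const 5) fun j => by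
    cases hm : m j with
    | zero => exact ⟨_, by norm_num, .condFalse (.skip _) (.cons (.nil _) (.nil _))⟩
    | succ n =>
      rw [enc_succ]
      exact ⟨_, by norm_num, .condTrue (.skip _) (.nil _)⟩)

/-- The program that tests whether the input is `c`. -/
def Prog.eqConst : Data → Prog
  | .nil => .cond .skip .nil (.cons .nil .nil)
  | .cons a b =>
    .cond .skip (.cond (.seq .hd (Prog.eqConst a)) (.seq .tl (Prog.eqConst b)) .nil) .nil

-- The recursion follows the fixed tree `c`, so the time is bounded in terms of `c` however large
-- `x` is. Membership in a fixed finite relation is therefore tested in constant time.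
open Classical in
theorem Prog.exists_runs_eqConst (c : Data) :
    ∃ T, ∀ x, ∃ t ≤ T, Runs (Prog.eqConst c) x (enc (decide (x = c))) t := by
  induction c with
  | nil =>
    refine ⟨5, fun x => ?_⟩
    cases x with
    | nil =>
      rw [decide_eq_true rfl]
      exact ⟨_, by norm_num, .condFalse (.skip _) (.cons (.nil _) (.nil _))⟩
    | cons a b =>
      rw [decide_eq_false (by simp)]
      exact ⟨_, by norm_num, .condTrue (.skip _) (.nil _)⟩
  | cons a b iha ihb =>
    obtain ⟨A, hA⟩ := iha
    obtain ⟨B, hB⟩ := ihb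
    refine ⟨A + B + 20, fun x => ?_⟩
    cases x with
    | nil =>
      rw [decide_eq_false (by simp)]
      exact ⟨_, by omega, .condFalse (.skip _) (.nil _)⟩
    | cons x y =>
      obtain ⟨s, hs, hr⟩ := hA x
      obtain ⟨t, ht, hr'⟩ := hB y
      by_cases hx : x = a
      · subst hx
        simp only [decide_true] at hr
        simp only [Data.cons.injEq, true_and]
        exact ⟨_, by omega, .condTrue (.skip _) (.condTrue (.seq (.hd _) hr) (.seq (.tl _) hr'))⟩
      · simp only [hx, decide_false] at hr
        simp only [Data.cons.injEq, hx, false_and]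
        exact ⟨_, by omega, .condTrue (.skip _) (.condFalse (.seq (.hd _) hr) (.nil _))⟩

open Classical in
theorem Fpt.eq_const (h : Fpt μ e f) (a : α) : Fpt μ e (fun j => decide (f j = a)) := by
  obtain ⟨T, hT⟩ := Prog.exists_runs_eqConst (enc a)
  refine h.comp (.of_bd (Prog.eqConst (enc a)) (Bd.const T) fun j => ?_)
  simpa only [inj.eq_iff] using hT (enc (f j))

open Classical in
theorem Fpt.mem_const (h : Fpt μ e f) (A : List α) : Fpt μ e (fun j => decide (f j ∈ A)) := by
  induction A with
  | nil => exact (Fpt.const false).of_eq fun j => by simp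
  | cons a A ih => exact ((h.eq_const a).or ih).of_eq fun j => by simp

/-! ### Loops over lists -/

/-- The points at which the body of a loop over `l` is run, with invariant `P` for the state after
a given number of rounds. -/
abbrev LoopIdx (l : J → List α) (P : J → ℕ → σ → Prop) :=
  {x : J × σ × α // x.2.2 ∈ l x.1 ∧ ∃ i < (l x.1).length, P x.1 i x.2.1}

/-- The loop acts on the remaining list, the accumulator and the original input; its test is the
head, which is `nil` exactly when the list is exhausted. The body needs its time bound only at
points satisfying the invariant `P`, which is how size bounds on intermediate results enter. -/
theorem Fpt.foldl {l : J → List α} {s : J → σ} {g : J → σ → α → σ} (P : J → ℕ → σ → Prop)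
    (hl : Fpt μ e l) (hn : Bd μ (fun j => (l j).length)) (hs : Fpt μ e s) (h0 : ∀ j, P j 0 (s j))
    (hP : ∀ j, ∀ a ∈ l j, ∀ i < (l j).length, ∀ x, P j i x → P j (i + 1) (g j x a))
    (hg : Fpt (fun x : LoopIdx l P => μ x.1.1) (fun x => (x.1.2.2, x.1.2.1, e x.1.1))
      (fun x => g x.1.1 x.1.2.1 x.1.2.2)) :
    Fpt μ e (fun j => (l j).foldl (g j) (s j)) := by
  obtain ⟨pl, A, hA, hl⟩ := hl.exists_bd
  obtain ⟨ps, B, hB, hs⟩ := hs.exists_bd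
  obtain ⟨pg, F, c, hF, hg⟩ := hg
  let C : J → ℕ := fun j => F (μ j).1 * ((μ j).2 + 1) ^ c
  have hC : Bd μ C := ⟨F, c, hF, fun _ => le_rfl⟩
  let lp : Prog := .loop .hd (.cons (.seq .hd .tl)
    (.cons (.seq (.cons (.seq .hd .hd) .tl) pg) (.seq .tl .tl)))
  -- The 20 covers the bookkeeping of one round, the 2 the final failing test.
  have key : ∀ j (l' : List α) (i : ℕ) (x : σ), (∀ a ∈ l', a ∈ l j) → i + l'.length = (l j).length →
      P j i x → ∃ t ≤ l'.length * (C j + 20) + 2,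
        Runs lp (enc (l', x, e j)) (enc (([] : List α), l'.foldl (g j) x, e j)) t := by
    intro j l'
    induction l' with
    | nil =>
      intro i x _ _ _
      exact ⟨_, by simp, .loopStop (.hd _)⟩
    | cons a l' ih =>
      intro i x hl' hi hx
      have ha : a ∈ l j := hl' a (by simp)
      have hi' : i < (l j).length := by simp at hi; omega
      obtain ⟨t, ht, hr⟩ := ih (i + 1) (g j x a) (fun b hb => hl' b (by simp [hb]))
        (by simp at hi; omega) (hP j a ha i hi' x hx)
      obtain ⟨u, hu, hr'⟩ := hg ⟨(j, x, a), ha, i, hi', hx⟩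
      refine ⟨_, ?_, .loopStep (.hd _) (.cons (.seq (.hd _) (.tl _))
        (.cons (.seq (.cons (.seq (.hd _) (.hd _)) (.tl _)) hr') (.seq (.tl _) (.tl _)))) hr⟩
      have hu' : u ≤ C j := hu
      simp only [List.length_cons]
      rw [add_mul]
      omega
  refine .of_bd (.seq (.cons pl (.cons ps .skip)) (.seq lp (.seq .tl .hd)))
    (((hA.add hB).add (hn.mul (hC.add (Bd.const 20)))).add (Bd.const 20)) fun j => ?_
  obtain ⟨t, ht, hr⟩ := hl j
  obtain ⟨t', ht', hr'⟩ := hs j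
  obtain ⟨u, hu, hr''⟩ := key j (l j) 0 (s j) (fun _ h => h) (by simp) (h0 j)
  exact ⟨_, by omega, .seq (.cons hr (.cons hr' (.skip _))) (.seq hr'' (.seq (.tl _) (.hd _)))⟩

section LoopIdx

variable {l : J → List α} {P : J → ℕ → σ → Prop}

theorem Fpt.inLoop (h : Fpt μ e g) : Fpt (fun x : LoopIdx l P => μ x.1.1)
    (fun x => (x.1.2.2, x.1.2.1, e x.1.1)) (fun x => g x.1.1) :=
  Fpt.comp Fpt.id.snd.snd (h.reindex _)

theorem Fpt.loopElem : Fpt (fun x : LoopIdx l P => μ x.1.1)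
    (fun x => (x.1.2.2, x.1.2.1, e x.1.1)) (fun x => x.1.2.2) :=
  Fpt.id.fst

theorem Fpt.loopState : Fpt (fun x : LoopIdx l P => μ x.1.1)
    (fun x => (x.1.2.2, x.1.2.1, e x.1.1)) (fun x => x.1.2.1) :=
  Fpt.id.snd.fst

end LoopIdx

/-- No invariant. -/
abbrev noInv : J → ℕ → σ → Prop := fun _ _ _ => True

theorem Fpt.reverse {l : J → List α} (hl : Fpt μ e l) (hn : Bd μ (fun j => (l j).length)) :
    Fpt μ e (fun j => (l j).reverse) :=
  (Fpt.foldl (s := fun _ => []) (g := fun _ s a => a :: s) noInv hl hn (.const _)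
    (fun _ => trivial) (fun _ _ _ _ _ _ _ => trivial) (loopElem.cons loopState)).of_eq
      fun j => by simp

theorem Fpt.foldr {l : J → List α} {s : J → σ} {g : J → α → σ → σ}
    (hl : Fpt μ e l) (hn : Bd μ (fun j => (l j).length)) (hs : Fpt μ e s)
    (hg : Fpt (fun x : LoopIdx l noInv => μ x.1.1) (fun x => (x.1.2.2, x.1.2.1, e x.1.1))
      (fun x => g x.1.1 x.1.2.2 x.1.2.1)) :
    Fpt μ e (fun j => (l j).foldr (g j) (s j)) := by
  refine (Fpt.foldl (g := fun j s a => g j a s) noInv (hl.reverse hn) (hn.mono (by simp)) hs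
    (fun _ => trivial) (fun _ _ _ _ _ _ _ => trivial) ?_).of_eq fun j => by simp
  exact hg.reindex (fun x : LoopIdx (fun j => (l j).reverse) noInv => ⟨x.1, by simpa using x.2⟩)

/-- The points at which a function is applied to the elements of `l`. -/
abbrev ElemIdx (l : J → List α) := {x : J × α // x.2 ∈ l x.1}

theorem Fpt.inElem {l : J → List α} (h : Fpt μ e g) : Fpt (fun x : ElemIdx l => μ x.1.1)
    (fun x => (x.1.2, e x.1.1)) (fun x => g x.1.1) :=
  Fpt.comp Fpt.id.snd (h.reindex _)

theorem Fpt.elem {l : J → List α} : Fpt (fun x : ElemIdx l => μ x.1.1)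
    (fun x => (x.1.2, e x.1.1)) (fun x => x.1.2) :=
  Fpt.id.fst

theorem Fpt.elemToLoop {l : J → List α} {P : J → ℕ → σ → Prop} {h : J → α → β}
    (hh : Fpt (fun x : ElemIdx l => μ x.1.1) (fun x => (x.1.2, e x.1.1))
      (fun x => h x.1.1 x.1.2)) :
    Fpt (fun x : LoopIdx l P => μ x.1.1) (fun x => (x.1.2.2, x.1.2.1, e x.1.1))
      (fun x => h x.1.1 x.1.2.2) :=
  Fpt.comp (Fpt.pair Fpt.id.fst Fpt.id.snd.snd)
    (hh.reindex (fun x : LoopIdx l P => ⟨(x.1.1, x.1.2.2), x.2.1⟩))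

theorem Fpt.map {l : J → List α} {h : J → α → β} (hl : Fpt μ e l)
    (hn : Bd μ (fun j => (l j).length))
    (hh : Fpt (fun x : ElemIdx l => μ x.1.1) (fun x => (x.1.2, e x.1.1))
      (fun x => h x.1.1 x.1.2)) :
    Fpt μ e (fun j => (l j).map (h j)) :=
  (Fpt.foldr (s := fun _ => []) (g := fun j a s => h j a :: s) hl hn (.const _)
    (hh.elemToLoop.cons loopState)).of_eq fun j => by
      induction l j with
      | nil => rfl
      | cons a l ih => simp

theorem Fpt.filter {l : J → List α} {h : J → α → Bool} (hl : Fpt μ e l)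
    (hn : Bd μ (fun j => (l j).length))
    (hh : Fpt (fun x : ElemIdx l => μ x.1.1) (fun x => (x.1.2, e x.1.1))
      (fun x => h x.1.1 x.1.2)) :
    Fpt μ e (fun j => (l j).filter (h j)) :=
  (Fpt.foldr (s := fun _ => []) (g := fun j a s => if h j a then a :: s else s) hl hn (.const _)
    (hh.elemToLoop.ite (loopElem.cons loopState) loopState)).of_eq fun j => by
      induction l j with
      | nil => rfl
      | cons a l ih => simp [List.filter_cons, ih]

theorem Fpt.any {l : J → List α} {h : J → α → Bool} (hl : Fpt μ e l)
    (hn : Bd μ (fun j => (l j).length))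
    (hh : Fpt (fun x : ElemIdx l => μ x.1.1) (fun x => (x.1.2, e x.1.1))
      (fun x => h x.1.1 x.1.2)) :
    Fpt μ e (fun j => (l j).any (h j)) :=
  (Fpt.foldr (s := fun _ => false) (g := fun j a s => h j a || s) hl hn (.const _)
    (hh.elemToLoop.or loopState)).of_eq fun j => by
      induction l j with
      | nil => rfl
      | cons a l ih => simp [ih]

theorem Fpt.all {l : J → List α} {h : J → α → Bool} (hl : Fpt μ e l)
    (hn : Bd μ (fun j => (l j).length))
    (hh : Fpt (fun x : ElemIdx l => μ x.1.1) (fun x => (x.1.2, e x.1.1))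
      (fun x => h x.1.1 x.1.2)) :
    Fpt μ e (fun j => (l j).all (h j)) :=
  (Fpt.foldr (s := fun _ => true) (g := fun j a s => h j a && s) hl hn (.const _)
    (hh.elemToLoop.and loopState)).of_eq fun j => by
      induction l j with
      | nil => rfl
      | cons a l ih => rw [List.all_cons, ih, List.foldr_cons]

theorem Fpt.append {l l' : J → List α} (hl : Fpt μ e l) (hn : Bd μ (fun j => (l j).length))
    (hl' : Fpt μ e l') : Fpt μ e (fun j => l j ++ l' j) :=
  (Fpt.foldr (g := fun _ a s => a :: s) hl hn hl' (loopElem.cons loopState)).of_eq fun j => by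
    simp

theorem Fpt.flatMap {l : J → List α} {h : J → α → List β} (hl : Fpt μ e l)
    (hn : Bd μ (fun j => (l j).length))
    (hh : Fpt (fun x : ElemIdx l => μ x.1.1) (fun x => (x.1.2, e x.1.1))
      (fun x => h x.1.1 x.1.2))
    (hb : Bd (fun x : ElemIdx l => μ x.1.1) (fun x => (h x.1.1 x.1.2).length)) :
    Fpt μ e (fun j => (l j).flatMap (h j)) :=
  (Fpt.foldr (s := fun _ => []) (g := fun j a s => h j a ++ s) hl hn (.const _)
    (hh.elemToLoop.append (hb.reindex (fun x : LoopIdx l noInv => ⟨(x.1.1, x.1.2.2), x.2.1⟩))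
      loopState)).of_eq fun j => by
      induction l j with
      | nil => rfl
      | cons a l ih => simp [ih]

theorem Fpt.length {l : J → List α} (hl : Fpt μ e l) (hn : Bd μ (fun j => (l j).length)) :
    Fpt μ e (fun j => (l j).length) :=
  (Fpt.foldr (s := fun _ => 0) (g := fun _ _ s => s + 1) hl hn (.const _) loopState.succ).of_eq
    fun j => by
      induction l j with
      | nil => rfl
      | cons a l ih => rw [List.length_cons, ih, List.foldr_cons]

/-- The flag records whether any of the `a` decrements of `b` was attempted at zero. -/
theorem foldr_units_eq (a b : ℕ) :
    ((List.replicate a ()).foldr (fun _ s => (s.1 && !decide (s.2 = 0), s.2 - 1)) (true, b)) =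
      (decide (a ≤ b), b - a) := by
  induction a with
  | zero => rfl
  | succ a ih =>
    rw [List.replicate_succ, List.foldr_cons, ih]
    ext
    · simp only [← decide_not, ← Bool.decide_and, decide_eq_decide]; omega
    · simp only; omega

/-- The loop runs over `a` alone, so `b` needs no bound. This matters for the prescribed
multiplicities, which neither the size nor the parameter controls. -/
theorem Fpt.natEq {a b : J → ℕ} (ha : Fpt μ e a) (hb : Fpt μ e b) (hn : Bd μ a) :
    Fpt μ e (fun j => decide (a j = b j)) := by
  have h := Fpt.foldr (g := fun _ _ s => (s.1 && !decide (s.2 = 0), s.2 - 1)) ha.units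
    (hn.mono (by simp)) (Fpt.pair (Fpt.const true) hb)
    ((loopState.fst.and loopState.snd.eq_zero.not).pair loopState.snd.pred)
  refine (h.fst.and h.snd.eq_zero).of_eq fun j => ?_
  rw [foldr_units_eq, ← Bool.decide_and, decide_eq_decide]
  omega

theorem Fpt.natMem {a : J → ℕ} {l : J → List ℕ} (ha : Fpt μ e a) (hl : Fpt μ e l)
    (hn : Bd μ (fun j => (l j).length)) (hb : Bd μ a) : Fpt μ e (fun j => decide (a j ∈ l j)) :=
  (Fpt.any (h := fun j b => decide (a j = b)) hl hn
    (ha.inElem.natEq elem (hb.reindex _))).of_eq fun j => by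
      rw [Bool.eq_iff_iff]; simp

end SizeCSP
namespace SizeCSP

open Enc

/-! ### The algorithm

Variables and values are natural numbers, with `0` for the value zero. A constraint consists of the
code of its relation and its scope, and the list `A` holds the pairs of a code and a tuple in the
relation with this code. -/

/-- A partial assignment (a list of variables with their values), together with the list of the
values that are still to be used. -/
abbrev State := List (ℕ × ℕ) × List ℕ

/-- The assignment given by a list of variables with values. -/
def asg (S : List (ℕ × ℕ)) (v : ℕ) : ℕ :=
  S.foldr (fun p s => if decide (v = p.1) then p.2 else s) 0

/-- The assignment given by `S` satisfies the constraint `c`. -/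
def holds (A : List (ℕ × List ℕ)) (S : List (ℕ × ℕ)) (c : ℕ × List ℕ) : Bool :=
  decide ((c.1, c.2.map (asg S)) ∈ A)

/-- The assignment given by `S` satisfies all constraints. -/
def sat (A : List (ℕ × List ℕ)) (cs : List (ℕ × List ℕ)) (S : List (ℕ × ℕ)) : Bool :=
  cs.all (holds A S)

/-- The variables on which to branch: the scope of the first violated constraint, or `W`. -/
def cand (A : List (ℕ × List ℕ)) (cs : List (ℕ × List ℕ)) (W : List ℕ) (S : List (ℕ × ℕ)) :
    List ℕ :=
  cs.foldr (fun c s => if holds A S c then s else c.2) W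

/-- The states that arise by giving one of the remaining values to a variable in `Z` that has no
value yet and is not in `U`. -/
def children (U Z : List ℕ) (x : State) : List State :=
  (Z.filter fun v => decide (asg x.1 v = 0) && !decide (v ∈ U)).flatMap fun v =>
    x.2.map fun a => ((v, a) :: x.1, x.2.erase a)

/-- One round of branching. -/
def expand (A : List (ℕ × List ℕ)) (cs : List (ℕ × List ℕ)) (U W : List ℕ) (x : State) :
    List State :=
  children U (cand A cs W x.1) x

/-- Branching from the states in `Q`, with as many rounds as `t` has entries. -/
def search (A : List (ℕ × List ℕ)) (cs : List (ℕ × List ℕ)) (U W : List ℕ) (Q : List State)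
    (t : List ℕ) : List State :=
  t.foldl (fun Q _ => Q.flatMap (expand A cs U W)) Q

/-- The variables `0, …, n - 1`. -/
def vars (n : ℕ) : List ℕ :=
  ((List.replicate n ()).foldl (fun s _ => (s.2 :: s.1, s.2 + 1)) (([] : List ℕ), 0)).1

/-- The nonzero values. -/
def vals (d : ℕ) : List ℕ := (List.range d).map (· + 1)

/-- The lists of at most `k` nonzero values. -/
def types (d k : ℕ) : List (List ℕ) :=
  (List.replicate k ()).foldl
    (fun X _ => [] :: X.flatMap fun t => (vals d).map fun a => a :: t) [[]]

/-- Add to `W` the variables of some solution with value list `t` that avoids `W`, if the search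
finds one. -/
def greedyStep (A : List (ℕ × List ℕ)) (n : ℕ) (cs : List (ℕ × List ℕ)) (W t : List ℕ) :
    List ℕ :=
  (search A cs W [] (children W (vars n) ([], t)) t.tail).foldr
    (fun x s => if sat A cs x.1 then x.1.map Prod.fst ++ W else s) W

/-- The variables of up to `k + 1` disjoint solutions for each list of at most `k` values. -/
def hubs (A : List (ℕ × List ℕ)) (d n : ℕ) (cs : List (ℕ × List ℕ)) (k : ℕ) : List ℕ :=
  ((types d k).flatMap fun t => (List.replicate (k + 1) ()).map fun _ => t).foldl
    (greedyStep A n cs) []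

/-- Is there a solution whose nonzero values are those in a list in `T`? -/
def solve (A : List (ℕ × List ℕ)) (d n : ℕ) (cs : List (ℕ × List ℕ)) (k : ℕ)
    (T : List (List ℕ)) : Bool :=
  T.any fun t => (search A cs [] (hubs A d n cs k) [([], t)] t).any fun x => sat A cs x.1

/-! ### Sizes of the intermediate results -/

theorem mem_vals {d a : ℕ} : a ∈ vals d ↔ 0 < a ∧ a ≤ d := by
  simp only [vals, List.mem_map, List.mem_range]
  constructor
  · rintro ⟨b, hb, rfl⟩; omega
  · rintro ⟨h, h'⟩; exact ⟨a - 1, by omega, by omega⟩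

theorem length_vals (d : ℕ) : (vals d).length = d := by simp [vals]

theorem foldl_vars (n : ℕ) :
    (List.replicate n ()).foldl (fun s _ => (s.2 :: s.1, s.2 + 1)) (([] : List ℕ), 0) =
      ((List.range n).reverse, n) := by
  induction n with
  | zero => rfl
  | succ n ih =>
    rw [List.replicate_succ', List.foldl_append, ih]
    simp [List.range_succ]

theorem vars_eq (n : ℕ) : vars n = (List.range n).reverse := by
  rw [vars, foldl_vars]

theorem mem_vars {n v : ℕ} : v ∈ vars n ↔ v < n := by simp [vars_eq]

theorem length_flatMap_le {α β : Type*} {l : List α} {f : α → List β} {b : ℕ}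
    (h : ∀ a ∈ l, (f a).length ≤ b) : (l.flatMap f).length ≤ l.length * b := by
  induction l with
  | nil => simp
  | cons a l ih =>
    have h1 := h a (by simp)
    have h2 := ih fun a ha => h a (by simp [ha])
    simp only [List.flatMap_cons, List.length_append, List.length_cons, add_mul]
    omega

theorem types_succ (d k : ℕ) :
    types d (k + 1) = [] :: (types d k).flatMap fun t => (vals d).map fun a => a :: t := by
  rw [types, List.replicate_succ', List.foldl_append]
  rfl

theorem mem_types {d k : ℕ} {t : List ℕ} : t ∈ types d k ↔ t.length ≤ k ∧ ∀ a ∈ t, a ∈ vals d := by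
  induction k generalizing t with
  | zero =>
    have : types d 0 = [[]] := rfl
    rw [this]
    simp only [List.mem_singleton, Nat.le_zero, List.length_eq_zero_iff]
    constructor
    · rintro rfl; simp
    · exact fun h => h.1
  | succ k ih =>
    rw [types_succ]
    cases t with
    | nil => simp
    | cons a t =>
      simp only [List.mem_cons, reduceCtorEq, List.mem_flatMap, ih, List.mem_map, List.cons.injEq,
        false_or, List.length_cons, forall_eq_or_imp]
      constructor
      · rintro ⟨t', ⟨h1, h2⟩, b, hb, rfl, rfl⟩
        exact ⟨by omega, hb, h2⟩
      · rintro ⟨h1, h2, h3⟩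
        exact ⟨t, ⟨by omega, h3⟩, a, h2, rfl, rfl⟩

theorem length_types_step {d i : ℕ} {X : List (List ℕ)} (h : X.length ≤ (d + 1) ^ i) :
    ([] :: X.flatMap fun t => (vals d).map fun a => a :: t).length ≤ (d + 1) ^ (i + 1) := by
  have h1 : (X.flatMap fun t => (vals d).map fun a => a :: t).length ≤ X.length * d :=
    length_flatMap_le fun t _ => by simp [length_vals]
  have h2 : X.length * d ≤ (d + 1) ^ i * d := Nat.mul_le_mul_right _ h
  have h3 : 0 < (d + 1) ^ i := by positivity
  rw [List.length_cons, pow_succ, mul_add]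
  omega

theorem length_types_le (d k : ℕ) : (types d k).length ≤ (d + 1) ^ k := by
  induction k with
  | zero => exact le_rfl
  | succ k ih => rw [types_succ]; exact length_types_step ih

/-- The bounds that hold for all states. -/
def State.Bounded (d n k : ℕ) (x : State) : Prop :=
  x.1.length + x.2.length ≤ k ∧ (∀ p ∈ x.1, p.1 < n) ∧ ∀ a ∈ x.2, a ≤ d

theorem mem_children {U Z : List ℕ} {x y : State} : y ∈ children U Z x ↔
    ∃ v ∈ Z, asg x.1 v = 0 ∧ v ∉ U ∧ ∃ a ∈ x.2, y = ((v, a) :: x.1, x.2.erase a) := by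
  simp only [children, List.mem_flatMap, List.mem_filter, Bool.and_eq_true, decide_eq_true_eq,
    Bool.not_eq_true', decide_eq_false_iff_not, List.mem_map, and_assoc, @eq_comm _ y]

theorem length_children_le (U Z : List ℕ) (x : State) :
    (children U Z x).length ≤ Z.length * x.2.length :=
  (length_flatMap_le fun _ _ => (List.length_map _).le).trans
    (Nat.mul_le_mul_right _ (List.length_filter_le _ _))

theorem State.Bounded.children {d n k : ℕ} {U Z : List ℕ} {x y : State} (h : x.Bounded d n k)
    (hZ : ∀ v ∈ Z, v < n) (hy : y ∈ children U Z x) : y.Bounded d n k := by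
  obtain ⟨v, hv, -, -, a, ha, rfl⟩ := mem_children.1 hy
  obtain ⟨h1, h2, h3⟩ := h
  refine ⟨?_, ?_, fun b hb => h3 b (List.mem_of_mem_erase hb)⟩
  · have := List.length_pos_of_mem ha
    rw [List.length_erase_of_mem ha, List.length_cons]
    omega
  · simp only [List.mem_cons, forall_eq_or_imp]
    exact ⟨hZ v hv, h2⟩

theorem cand_eq (A : List (ℕ × List ℕ)) (cs : List (ℕ × List ℕ)) (W : List ℕ)
    (S : List (ℕ × ℕ)) : (sat A cs S = true ∧ cand A cs W S = W) ∨
      ∃ c ∈ cs, holds A S c = false ∧ cand A cs W S = c.2 := by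
  induction cs with
  | nil => exact .inl ⟨rfl, rfl⟩
  | cons c cs ih =>
    cases hc : holds A S c with
    | false => exact .inr ⟨c, by simp, hc, by simp [cand, hc]⟩
    | true =>
      have h1 : cand A (c :: cs) W S = cand A cs W S := by simp [cand, hc]
      have h2 : sat A (c :: cs) S = sat A cs S := by simp [sat, hc]
      rw [h1, h2]
      rcases ih with h | ⟨c', hc', h⟩
      · exact .inl h
      · exact .inr ⟨c', by simp [hc'], h⟩

section Cand

variable {A cs : List (ℕ × List ℕ)} {W : List ℕ} {S : List (ℕ × ℕ)} {n r : ℕ}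

theorem cand_lt (hW : ∀ v ∈ W, v < n) (hcs : ∀ c ∈ cs, ∀ v ∈ c.2, v < n) :
    ∀ v ∈ cand A cs W S, v < n := by
  rcases cand_eq A cs W S with ⟨-, h⟩ | ⟨c, hc, -, h⟩
  · rwa [h]
  · rw [h]; exact hcs c hc

theorem length_cand_le (hcs : ∀ c ∈ cs, c.2.length ≤ r) :
    (cand A cs W S).length ≤ W.length + r := by
  rcases cand_eq A cs W S with ⟨-, h⟩ | ⟨c, hc, -, h⟩
  · rw [h]; omega
  · rw [h]; have := hcs c hc; omega

end Cand

theorem State.Bounded.search {A cs : List (ℕ × List ℕ)} {d n k : ℕ} {U W t : List ℕ}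
    {Q : List State} (hQ : ∀ x ∈ Q, x.Bounded d n k) (hW : ∀ v ∈ W, v < n)
    (hcs : ∀ c ∈ cs, ∀ v ∈ c.2, v < n) : ∀ x ∈ search A cs U W Q t, x.Bounded d n k := by
  induction t generalizing Q with
  | nil => exact hQ
  | cons a t ih =>
    refine ih fun y hy => ?_
    obtain ⟨x, hx, hy⟩ := List.mem_flatMap.1 hy
    exact (hQ x hx).children (cand_lt hW hcs) hy

theorem greedyStep_eq (A : List (ℕ × List ℕ)) (n : ℕ) (cs : List (ℕ × List ℕ)) (W t : List ℕ) :
    (greedyStep A n cs W t = W ∧ ∀ x ∈ search A cs W [] (children W (vars n) ([], t)) t.tail,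
      sat A cs x.1 = false) ∨
    ∃ x ∈ search A cs W [] (children W (vars n) ([], t)) t.tail,
      sat A cs x.1 = true ∧ greedyStep A n cs W t = x.1.map Prod.fst ++ W := by
  rw [greedyStep]
  induction search A cs W [] (children W (vars n) ([], t)) t.tail with
  | nil => simp
  | cons x Q ih =>
    rw [List.foldr_cons]
    cases hx : sat A cs x.1 with
    | true => exact .inr ⟨x, by simp, hx, by simp⟩
    | false =>
      simp only [Bool.false_eq_true, if_false, List.mem_cons, forall_eq_or_imp, hx, true_and,
        exists_eq_or_imp, false_and, false_or]
      exact ih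

theorem greedyStep_bounded {A cs : List (ℕ × List ℕ)} {d n k : ℕ} {W t : List ℕ}
    (hcs : ∀ c ∈ cs, ∀ v ∈ c.2, v < n) (hW : ∀ v ∈ W, v < n) (ht : t ∈ types d k) :
    (greedyStep A n cs W t).length ≤ W.length + k ∧ ∀ v ∈ greedyStep A n cs W t, v < n := by
  rcases greedyStep_eq A n cs W t with ⟨h, -⟩ | ⟨x, hx, -, h⟩
  · rw [h]; exact ⟨by omega, hW⟩
  · obtain ⟨h1, h2⟩ := mem_types.1 ht
    have hb : State.Bounded d n k ([], t) :=
      ⟨by simpa using h1, by simp, fun a ha => (mem_vals.1 (h2 a ha)).2⟩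
    have hx := State.Bounded.search (fun y hy => hb.children (fun v hv => mem_vars.1 hv) hy)
      (by simp) hcs x hx
    rw [h]
    refine ⟨?_, fun v hv => ?_⟩
    · have := hx.1
      simp only [List.length_append, List.length_map]
      omega
    · rcases List.mem_append.1 hv with hv | hv
      · obtain ⟨p, hp, rfl⟩ := List.mem_map.1 hv
        exact hx.2.1 p hp
      · exact hW v hv

/-! ### Running times -/

variable {J : Type*} {μ : J → ℕ × ℕ} {ε : Type*} [Enc ε] {e : J → ε}

theorem Fpt.vars {n : J → ℕ} (h : Fpt μ e n) (hn : Bd μ n) : Fpt μ e (fun j => vars (n j)) :=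
  Fpt.fst (Fpt.foldl (g := fun _ s _ => (s.2 :: s.1, s.2 + 1)) noInv h.units
    (hn.mono (by simp)) (Fpt.const (([] : List ℕ), 0))
    (fun _ => trivial) (fun _ _ _ _ _ _ _ => trivial)
    ((loopState.snd.cons loopState.fst).pair loopState.snd.succ))

theorem Fpt.types (d : ℕ) {k : J → ℕ} (h : Fpt μ e k) (hk : BdK μ k) :
    Fpt μ e (fun j => types d (k j)) := by
  have hB : Bd μ (fun j => (d + 1) ^ k j) := ((BdK.const d).pow hk).bd
  refine Fpt.foldl (g := fun _ X _ => [] :: X.flatMap fun t => (vals d).map fun a => a :: t)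
    (fun _ i X => X.length ≤ (d + 1) ^ i) h.units (hk.bd.mono (by simp)) (Fpt.const [[]])
    (fun _ => le_rfl) (fun _ _ _ _ _ _ hX => length_types_step hX) ?_
  refine (Fpt.const []).cons (Fpt.flatMap (h := fun _ t => (vals d).map fun a => a :: t)
    loopState ?_ ?_ ?_)
  · refine (hB.reindex _).mono ?_
    rintro ⟨⟨j, X, a⟩, -, i, hi, hX⟩
    exact hX.trans (Nat.pow_le_pow_right (by omega) (by simpa using hi.le))
  · exact Fpt.map (h := fun (x : ElemIdx fun x : LoopIdx _ _ => x.1.2.1) a => a :: x.1.2)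
      (.const (vals d)) (Bd.const _) (Fpt.id.fst.cons Fpt.id.snd.fst)
  · exact (Bd.const d).mono (by simp [length_vals])

/-- A fold from the right sees the first occurrence last. It carries both the untouched suffix and
the suffix after erasure, and falls back on the former whenever it meets `a j`. -/
theorem Fpt.erase {l : J → List ℕ} {a : J → ℕ} (hl : Fpt μ e l)
    (hn : Bd μ (fun j => (l j).length)) (ha : Fpt μ e a) (hb : Bd μ a) :
    Fpt μ e (fun j => (l j).erase (a j)) := by
  have h := Fpt.foldr (s := fun _ => (([] : List ℕ), ([] : List ℕ)))
    (g := fun j b s => (b :: s.1, if decide (a j = b) then s.1 else b :: s.2)) hl hn (.const _)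
    ((loopElem.cons loopState.fst).pair ((ha.inLoop.natEq loopElem (hb.reindex _)).ite
      loopState.fst (loopElem.cons loopState.snd)))
  refine h.snd.of_eq fun j => ?_
  suffices hs : ∀ l : List ℕ, l.foldr (fun b s => (b :: s.1, if decide (a j = b) then s.1
      else b :: s.2)) (([] : List ℕ), ([] : List ℕ)) = (l, l.erase (a j)) by rw [hs]
  intro l
  induction l with
  | nil => rfl
  | cons b l ih =>
    rw [List.foldr_cons, ih, List.erase_cons]
    simp only [decide_eq_true_eq, beq_iff_eq, @eq_comm _ b]

theorem Fpt.asg {S : J → List (ℕ × ℕ)} {v : J → ℕ} (hS : Fpt μ e S)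
    (hn : Bd μ (fun j => (S j).length)) (hv : Fpt μ e v) (hb : Bd μ v) :
    Fpt μ e (fun j => asg (S j) (v j)) :=
  Fpt.foldr (g := fun j (p : ℕ × ℕ) s => if decide (v j = p.1) then p.2 else s) hS hn (.const 0)
    ((hv.inLoop.natEq loopElem.fst (hb.reindex _)).ite loopElem.snd loopState)

theorem Fpt.holds (A : List (ℕ × List ℕ)) {S : J → List (ℕ × ℕ)} {c : J → ℕ × List ℕ} {n : J → ℕ}
    (hS : Fpt μ e S) (hn : Bd μ (fun j => (S j).length)) (hc : Fpt μ e c)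
    (hl : Bd μ (fun j => (c j).2.length)) (hb : Bd μ n) (hcn : ∀ j, ∀ v ∈ (c j).2, v < n j) :
    Fpt μ e (fun j => holds A (S j) (c j)) := by
  refine (Fpt.mem_const (hc.fst.pair (Fpt.map (h := fun j v => SizeCSP.asg (S j) v) hc.snd hl
    (hS.inElem.asg (hn.reindex _) elem ((hb.reindex _).mono ?_)))) A).of_eq fun j => ?_
  · rintro ⟨⟨j, v⟩, hv⟩
    exact (hcn j v hv).le
  · exact decide_eq_decide.2 Iff.rfl

/-! ### Running times of the search and of the collection of hubs. -/

/-- The data of an instance are available, with the bounds needed for the algorithm. -/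
structure FptCSP (μ : J → ℕ × ℕ) (e : J → ε) (r : ℕ) (n : J → ℕ) (cs : J → List (ℕ × List ℕ))
    (k : J → ℕ) : Prop where
  fpt_n : Fpt μ e n
  bd_n : Bd μ n
  fpt_cs : Fpt μ e cs
  bd_cs : Bd μ (fun j => (cs j).length)
  fpt_k : Fpt μ e k
  bd_k : BdK μ k
  length_scope : ∀ j, ∀ c ∈ cs j, c.2.length ≤ r
  scope_lt : ∀ j, ∀ c ∈ cs j, ∀ v ∈ c.2, v < n j

section

variable {r d : ℕ} {n : J → ℕ} {cs : J → List (ℕ × List ℕ)} {k : J → ℕ}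
  (A : List (ℕ × List ℕ)) {α σ : Type*} [Enc α] [Enc σ]

theorem FptCSP.of_snd {J' : Type*} {ε' : Type*} [Enc ε'] (h : FptCSP μ e r n cs k) (φ : J' → J)
    {e' : J' → ε'} (he : Fpt (fun x => μ (φ x)) e' (fun x => e (φ x))) :
    FptCSP (fun x => μ (φ x)) e' r (fun x => n (φ x)) (fun x => cs (φ x)) (fun x => k (φ x)) where
  fpt_n := he.comp (h.fpt_n.reindex φ)
  bd_n := h.bd_n.reindex φ
  fpt_cs := he.comp (h.fpt_cs.reindex φ)
  bd_cs := h.bd_cs.reindex φ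
  fpt_k := he.comp (h.fpt_k.reindex φ)
  bd_k := h.bd_k.reindex φ
  length_scope x := h.length_scope (φ x)
  scope_lt x := h.scope_lt (φ x)

theorem FptCSP.inElem {l : J → List α} (h : FptCSP μ e r n cs k) :
    FptCSP (fun x : ElemIdx l => μ x.1.1) (fun x => (x.1.2, e x.1.1)) r (fun x => n x.1.1)
      (fun x => cs x.1.1) (fun x => k x.1.1) :=
  h.of_snd (fun x : ElemIdx l => x.1.1) Fpt.id.snd

theorem FptCSP.inLoop {l : J → List α} {P : J → ℕ → σ → Prop} (h : FptCSP μ e r n cs k) :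
    FptCSP (fun x : LoopIdx l P => μ x.1.1) (fun x => (x.1.2.2, x.1.2.1, e x.1.1)) r
      (fun x => n x.1.1) (fun x => cs x.1.1) (fun x => k x.1.1) :=
  h.of_snd (fun x : LoopIdx l P => x.1.1) Fpt.id.snd.snd

theorem FptCSP.holds (h : FptCSP μ e r n cs k) {S : J → List (ℕ × ℕ)} (hS : Fpt μ e S)
    (hn : Bd μ (fun j => (S j).length)) :
    Fpt (fun x : ElemIdx cs => μ x.1.1) (fun x => (x.1.2, e x.1.1))
      (fun x => holds A (S x.1.1) x.1.2) :=
  Fpt.holds A hS.inElem (hn.reindex _) Fpt.elem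
    ((Bd.const r).mono fun x => h.length_scope x.1.1 x.1.2 x.2) (h.bd_n.reindex _)
    (fun x => h.scope_lt x.1.1 x.1.2 x.2)

theorem FptCSP.sat (h : FptCSP μ e r n cs k) {S : J → List (ℕ × ℕ)} (hS : Fpt μ e S)
    (hn : Bd μ (fun j => (S j).length)) : Fpt μ e (fun j => sat A (cs j) (S j)) :=
  Fpt.all (h := fun j c => SizeCSP.holds A (S j) c) h.fpt_cs h.bd_cs (h.holds A hS hn)

theorem FptCSP.cand (h : FptCSP μ e r n cs k) {S : J → List (ℕ × ℕ)} (hS : Fpt μ e S)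
    (hn : Bd μ (fun j => (S j).length)) {W : J → List ℕ} (hW : Fpt μ e W) :
    Fpt μ e (fun j => cand A (cs j) (W j) (S j)) :=
  Fpt.foldr (g := fun j c s => if SizeCSP.holds A (S j) c then s else c.2) h.fpt_cs h.bd_cs hW
    ((Fpt.elemToLoop (h := fun j c => SizeCSP.holds A (S j) c) (h.holds A hS hn)).ite
      Fpt.loopState Fpt.loopElem.snd)

theorem Fpt.children {U Z : J → List ℕ} {x : J → State} (hn : Bd μ n) (hk : Bd μ k)
    (hU : Fpt μ e U) (hbU : Bd μ (fun j => (U j).length))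
    (hZ : Fpt μ e Z) (hbZ : Bd μ (fun j => (Z j).length)) (hZn : ∀ j, ∀ v ∈ Z j, v < n j)
    (hx : Fpt μ e x) (hbx : ∀ j, (x j).Bounded d (n j) (k j)) :
    Fpt μ e (fun j => children (U j) (Z j) (x j)) := by
  have hx1 : Bd μ (fun j => (x j).1.length) := hk.mono fun j => by have := (hbx j).1; omega
  have hx2 : Bd μ (fun j => (x j).2.length) := hk.mono fun j => by have := (hbx j).1; omega
  have hv : Bd (fun y : ElemIdx Z => μ y.1.1) (fun y => y.1.2) :=
    (hn.reindex _).mono fun y => (hZn y.1.1 y.1.2 y.2).le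
  refine Fpt.flatMap (h := fun j v => (x j).2.map fun a => ((v, a) :: (x j).1, (x j).2.erase a))
    (Fpt.filter (h := fun j v => decide (SizeCSP.asg (x j).1 v = 0) && !decide (v ∈ U j)) hZ hbZ ?_)
    (hbZ.mono fun j => List.length_filter_le _ _) ?_ ?_
  · exact (hx.fst.inElem.asg (hx1.reindex _) elem hv).eq_zero.and
      (elem.natMem hU.inElem (hbU.reindex _) hv).not
  · refine Fpt.map (h := fun y a => ((y.1.2, a) :: (x y.1.1).1, (x y.1.1).2.erase a))
      hx.snd.inElem (hx2.reindex _) ?_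
    refine ((Fpt.id.snd.fst.pair Fpt.id.fst).cons hx.fst.inElem.inElem).pair
      (hx.snd.inElem.inElem.erase ((hx2.reindex _).reindex _) Fpt.id.fst ((Bd.const d).mono ?_))
    rintro ⟨⟨⟨⟨j, v⟩, hv⟩, a⟩, ha⟩
    exact (hbx j).2.2 a ha
  · exact (hx2.reindex _).mono fun y => (List.length_map _).le

/-- A state has at most `B j = (|W| + r) * k` children and there are at most `k` rounds, so at most
`|Q| * (B + 1) ^ k` states survive. Hence `W` must be bounded in the parameter alone, while `Q` may
grow polynomially with the size. The length bound is needed for later loops over the result. -/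
theorem FptCSP.search (h : FptCSP μ e r n cs k) {U W t : J → List ℕ} {Q : J → List State}
    (hU : Fpt μ e U) (hbU : Bd μ (fun j => (U j).length)) (hW : Fpt μ e W)
    (hbW : BdK μ (fun j => (W j).length)) (hWn : ∀ j, ∀ v ∈ W j, v < n j)
    (hQ : Fpt μ e Q) (hbQ : Bd μ (fun j => (Q j).length))
    (hQ' : ∀ j, ∀ x ∈ Q j, x.Bounded d (n j) (k j))
    (ht : Fpt μ e t) (htk : ∀ j, (t j).length ≤ k j) :
    Fpt μ e (fun j => search A (cs j) (U j) (W j) (Q j) (t j)) ∧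
      Bd μ (fun j => (search A (cs j) (U j) (W j) (Q j) (t j)).length) := by
  let B : J → ℕ := fun j => ((W j).length + r) * k j
  have hB : BdK μ B := (hbW.add (.const r)).mul h.bd_k
  have hexp : ∀ j x, x.Bounded d (n j) (k j) →
      (expand A (cs j) (U j) (W j) x).length ≤ B j := fun j x hx =>
    (length_children_le _ _ _).trans (Nat.mul_le_mul (length_cand_le (h.length_scope j))
      (by have := hx.1; omega))
  let P : J → ℕ → List State → Prop := fun j i Q' =>
    (∀ x ∈ Q', x.Bounded d (n j) (k j)) ∧ Q'.length ≤ (Q j).length * (B j + 1) ^ i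
  have h0 : ∀ j, P j 0 (Q j) := fun j => ⟨hQ' j, by simp⟩
  have hstep : ∀ j i Q', P j i Q' → P j (i + 1) (Q'.flatMap (expand A (cs j) (U j) (W j))) := by
    rintro j i Q' ⟨h1, h2⟩
    refine ⟨fun y hy => ?_, ?_⟩
    · obtain ⟨x, hx, hy⟩ := List.mem_flatMap.1 hy
      exact (h1 x hx).children (cand_lt (hWn j) (h.scope_lt j)) hy
    · calc _ ≤ Q'.length * B j := length_flatMap_le fun x hx => hexp j x (h1 x hx)
        _ ≤ ((Q j).length * (B j + 1) ^ i) * (B j + 1) := Nat.mul_le_mul h2 (Nat.le_succ _)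
        _ = _ := by ring
  have hlen : Bd μ (fun j => (Q j).length * (B j + 1) ^ k j) := hbQ.mul (hB.pow h.bd_k).bd
  have hpow : ∀ j i, i ≤ (t j).length →
      (Q j).length * (B j + 1) ^ i ≤ (Q j).length * (B j + 1) ^ k j := fun j i hi =>
    Nat.mul_le_mul_left _ (Nat.pow_le_pow_right (by omega) (hi.trans (htk j)))
  constructor
  · refine Fpt.foldl (g := fun j Q' _ => Q'.flatMap (expand A (cs j) (U j) (W j))) P ht
      (h.bd_k.bd.mono htk) hQ h0 (fun j _ _ i _ Q' hP => hstep j i Q' hP) ?_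
    have hL : ∀ x : LoopIdx t P, ∀ y ∈ x.1.2.1, State.Bounded d (n x.1.1) (k x.1.1) y := by
      rintro ⟨⟨j, Q', a⟩, -, i, hi, h1, h2⟩
      exact h1
    refine Fpt.flatMap (h := fun (x : LoopIdx t P) y => expand A (cs x.1.1) (U x.1.1) (W x.1.1) y)
      Fpt.loopState ?_ ?_ ?_
    · refine (hlen.reindex _).mono ?_
      rintro ⟨⟨j, Q', a⟩, -, i, hi, h1, h2⟩
      exact h2.trans (hpow j i hi.le)
    · have h2 := (h.inLoop (l := t) (P := P)).inElem (l := fun x : LoopIdx t P => x.1.2.1)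
      refine Fpt.children (d := d) h2.bd_n h2.bd_k.bd hU.inLoop.inElem
        ((hbU.reindex _).reindex _) (h2.cand A Fpt.id.fst.fst (h2.bd_k.bd.mono ?_) hW.inLoop.inElem)
        ((((hbW.add (.const r)).bd.reindex _).reindex _).mono ?_) ?_ Fpt.id.fst ?_
      · intro x; exact (Nat.le_add_right _ _).trans (hL x.1.1 x.1.2 x.2).1
      · intro x; exact length_cand_le (h2.length_scope x)
      · intro x; exact cand_lt (hWn _) (h2.scope_lt x)
      · intro x; exact hL x.1.1 x.1.2 x.2
    · exact ((hB.bd.reindex _).reindex _).mono fun x => hexp _ _ (hL x.1.1 x.1.2 x.2)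
  · refine hlen.mono fun j => ?_
    have key : ∀ (t : List ℕ) (i : ℕ) (Q' : List State), P j i Q' →
        P j (i + t.length) (SizeCSP.search A (cs j) (U j) (W j) Q' t) := by
      intro t
      induction t with
      | nil => exact fun i Q' h => h
      | cons a t ih =>
        intro i Q' hP
        have := ih (i + 1) _ (hstep j i Q' hP)
        rwa [add_assoc, add_comm 1] at this
    exact (key (t j) 0 (Q j) (h0 j)).2.trans (hpow j _ (by simp))

/-- Guessing the first variable gives at most `n * k` starting states. This happens only once; all
later branching is over scopes of bounded length. -/
theorem FptCSP.greedyStep (h : FptCSP μ e r n cs k) {W t : J → List ℕ} (hW : Fpt μ e W)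
    (hbW : Bd μ (fun j => (W j).length)) (ht : Fpt μ e t)
    (htk : ∀ j, t j ∈ types d (k j)) :
    Fpt μ e (fun j => greedyStep A (n j) (cs j) (W j) (t j)) := by
  have hb : ∀ j, State.Bounded d (n j) (k j) ([], t j) := fun j => by
    obtain ⟨h1, h2⟩ := mem_types.1 (htk j)
    exact ⟨by simpa using h1, by simp, fun a ha => (mem_vals.1 (h2 a ha)).2⟩
  have hbV : Bd μ (fun j => (vars (n j)).length) := h.bd_n.mono fun j => by simp [vars_eq]
  have hchildren : ∀ j, ∀ x ∈ children (W j) (vars (n j)) ([], t j), x.Bounded d (n j) (k j) :=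
    fun j x hx => (hb j).children (fun v hv => mem_vars.1 hv) hx
  have hs := h.search A (d := d) (W := fun _ => []) (t := fun j => (t j).tail) hW hbW (.const [])
    (.const 0) (by simp)
    (Fpt.children (d := d) h.bd_n h.bd_k.bd hW hbW (h.fpt_n.vars h.bd_n) hbV
      (fun j v hv => mem_vars.1 hv) ((Fpt.const []).pair ht) hb)
    ((hbV.mul h.bd_k.bd).mono fun j => (length_children_le _ _ _).trans
      (Nat.mul_le_mul_left _ (mem_types.1 (htk j)).1))
    hchildren ht.tail (fun j => by have := (mem_types.1 (htk j)).1; simp; omega)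
  refine Fpt.foldr (g := fun j x s => if SizeCSP.sat A (cs j) x.1 then x.1.map Prod.fst ++ W j
    else s) hs.1 hs.2 hW ?_
  have hlen : ∀ {l : J → List State} {P : J → ℕ → List ℕ → Prop}, (∀ j, ∀ x ∈ l j,
      x.Bounded d (n j) (k j)) → Bd (fun x : LoopIdx l P => μ x.1.1) fun x => x.1.2.2.1.length :=
    fun hl => (h.bd_k.bd.reindex _).mono fun x => by
      have := (hl x.1.1 x.1.2.2 x.2.1).1; omega
  have hlen' := hlen (P := noInv) fun j => State.Bounded.search (A := A) (U := W j) (W := [])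
    (t := (t j).tail) (hchildren j) (by simp) (h.scope_lt j)
  exact (h.inLoop.sat A Fpt.loopElem.fst hlen').ite
    (Fpt.append (Fpt.map (h := fun _ p => p.1) Fpt.loopElem.fst hlen' Fpt.id.fst.fst)
      (hlen'.mono fun x => (List.length_map _).le) hW.inLoop) Fpt.loopState

theorem length_hub_rounds_le (d k : ℕ) :
    ((types d k).flatMap fun t => (List.replicate (k + 1) ()).map fun _ => t).length ≤
      (d + 1) ^ k * (k + 1) :=
  (length_flatMap_le fun t _ => by simp).trans (Nat.mul_le_mul_right _ (length_types_le d k))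

theorem mem_types_of_mem_rounds {d k : ℕ} {t : List ℕ}
    (ht : t ∈ (types d k).flatMap fun t => (List.replicate (k + 1) ()).map fun _ => t) :
    t ∈ types d k := by
  obtain ⟨t', ht', h⟩ := List.mem_flatMap.1 ht
  obtain ⟨-, -, rfl⟩ := List.mem_map.1 h
  exact ht'

theorem foldl_greedyStep_bounded {A cs : List (ℕ × List ℕ)} {d n k : ℕ}
    (hcs : ∀ c ∈ cs, ∀ v ∈ c.2, v < n) (L : List (List ℕ)) (hL : ∀ t ∈ L, t ∈ types d k)
    (W : List ℕ) (hW : ∀ v ∈ W, v < n) : (L.foldl (greedyStep A n cs) W).length ≤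
      W.length + L.length * k ∧ ∀ v ∈ L.foldl (greedyStep A n cs) W, v < n := by
  induction L generalizing W with
  | nil => exact ⟨by simp, hW⟩
  | cons t L ih =>
    obtain ⟨h1, h2⟩ := greedyStep_bounded (A := A) hcs hW (hL t (by simp))
    obtain ⟨h3, h4⟩ := ih (fun t ht => hL t (by simp [ht])) _ h2
    refine ⟨?_, h4⟩
    rw [List.length_cons, add_mul, List.foldl_cons]
    omega

theorem hubs_lt {A cs : List (ℕ × List ℕ)} {d n k : ℕ} (hcs : ∀ c ∈ cs, ∀ v ∈ c.2, v < n) :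
    ∀ v ∈ hubs A d n cs k, v < n :=
  (foldl_greedyStep_bounded hcs _ (fun _ => mem_types_of_mem_rounds) [] (by simp)).2

/-- At most `(d + 1) ^ k * (k + 1)` greedy rounds add at most `k` variables each, so the number of
hubs does not depend on the size of the instance. -/
theorem FptCSP.hubs (h : FptCSP μ e r n cs k) (d : ℕ) :
    Fpt μ e (fun j => hubs A d (n j) (cs j) (k j)) ∧
      BdK μ (fun j => (hubs A d (n j) (cs j) (k j)).length) := by
  have hB : BdK μ (fun j => (d + 1) ^ k j * (k j + 1)) :=
    ((BdK.const d).pow h.bd_k).mul (h.bd_k.add (.const 1))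
  constructor
  · refine Fpt.foldl (g := fun j => SizeCSP.greedyStep A (n j) (cs j))
      (fun j i W => W.length ≤ i * k j ∧ ∀ v ∈ W, v < n j)
      (Fpt.flatMap (h := fun j t => (List.replicate (k j + 1) ()).map fun _ => t)
        (h.fpt_k.types d h.bd_k)
        (((BdK.const d).pow h.bd_k).bd.mono fun j => length_types_le d (k j))
        (Fpt.map (h := fun (x : ElemIdx fun j => types d (k j)) _ => x.1.2)
          h.fpt_k.succ.units.inElem (((h.bd_k.add (.const 1)).bd.reindex _).mono (by simp)) Fpt.elem.inElem)
        (((h.bd_k.add (.const 1)).bd.reindex _).mono (by simp)))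
      (hB.bd.mono fun j => length_hub_rounds_le d (k j)) (.const []) (by simp) ?_ ?_
    · rintro j t ht i - W ⟨h1, h2⟩
      obtain ⟨h3, h4⟩ := greedyStep_bounded (A := A) (h.scope_lt j) h2 (mem_types_of_mem_rounds ht)
      exact ⟨by rw [add_mul]; omega, h4⟩
    · refine h.inLoop.greedyStep A (d := d) Fpt.loopState ?_ Fpt.loopElem
        fun x => mem_types_of_mem_rounds x.2.1
      refine (((hB.mul h.bd_k).bd).reindex _).mono ?_
      rintro ⟨⟨j, W, t⟩, -, i, hi, h1, h2⟩
      exact h1.trans (Nat.mul_le_mul_right _ (hi.le.trans (length_hub_rounds_le d (k j))))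
  · refine (hB.mul h.bd_k).mono fun j => ?_
    refine (foldl_greedyStep_bounded (h.scope_lt j) _ (fun _ => mem_types_of_mem_rounds) []
      (by simp)).1.trans ?_
    rw [List.length_nil, zero_add]
    exact Nat.mul_le_mul_right _ (length_hub_rounds_le d (k j))

theorem FptCSP.solve (h : FptCSP μ e r n cs k) (d : ℕ) {T : J → List (List ℕ)} (hT : Fpt μ e T)
    (hbT : Bd μ (fun j => (T j).length)) (hTk : ∀ j, ∀ t ∈ T j, t ∈ types d (k j)) :
    Fpt μ e (fun j => solve A d (n j) (cs j) (k j) (T j)) := by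
  obtain ⟨hW, hbW⟩ := h.hubs A d
  have hb : ∀ x : ElemIdx T, ∀ y ∈ [(([], x.1.2) : State)],
      State.Bounded d (n x.1.1) (k x.1.1) y := fun x y hy => by
    obtain ⟨h1, h2⟩ := mem_types.1 (hTk x.1.1 x.1.2 x.2)
    rw [List.mem_singleton.1 hy]
    exact ⟨by simpa using h1, by simp, fun a ha => (mem_vals.1 (h2 a ha)).2⟩
  have hs := (h.inElem (l := T)).search A (d := d) (U := fun _ => []) (t := fun x => x.1.2)
    (Q := fun x => [([], x.1.2)]) (.const []) (Bd.const 0) hW.inElem (hbW.reindex _)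
    (fun x => hubs_lt (h.scope_lt _)) (((Fpt.const []).pair Fpt.elem).cons (.const []))
    (Bd.const 1) hb Fpt.elem (fun x => (mem_types.1 (hTk x.1.1 x.1.2 x.2)).1)
  refine Fpt.any (h := fun j t => (SizeCSP.search A (cs j) [] (SizeCSP.hubs A d (n j) (cs j) (k j))
    [([], t)] t).any fun x => SizeCSP.sat A (cs j) x.1) hT hbT ?_
  refine Fpt.any (h := fun (x : ElemIdx T) y => SizeCSP.sat A (cs x.1.1) y.1) hs.1 hs.2
    (h.inElem.inElem.sat A Fpt.id.fst.fst
      ((h.bd_k.bd.reindex fun x : ElemIdx fun x : ElemIdx T => _ => x.1.1.1.1).mono ?_))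
  intro x
  have := (State.Bounded.search (A := A) (U := []) (t := x.1.1.1.2) (hb x.1.1) (hubs_lt (A := A)
    (h.scope_lt x.1.1.1.1)) (h.scope_lt x.1.1.1.1) x.1.2 x.2).1
  omega

end

end SizeCSP
namespace SizeCSP

/-! ### Solutions and their decompositions -/

/-- The functions `f` and `g` have disjoint supports. -/
def Disj (f g : ℕ → ℕ) : Prop := ∀ v, f v = 0 ∨ g v = 0

theorem Disj.symm {f g : ℕ → ℕ} (h : Disj f g) : Disj g f := fun v => (h v).symm

theorem Disj.add_right {f g h : ℕ → ℕ} (hg : Disj f g) (hh : Disj f h) : Disj f (g + h) :=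
  fun v => by
    have h1 := hg v
    have h2 := hh v
    simp only [Pi.add_apply]
    omega

theorem Disj.of_add_right {f g h : ℕ → ℕ} (hd : Disj f (g + h)) : Disj f g ∧ Disj f h :=
  ⟨fun v => by have := hd v; simp only [Pi.add_apply] at this; omega,
    fun v => by have := hd v; simp only [Pi.add_apply] at this; omega⟩

/-- The multiset of the nonzero values of `f` on `0, …, n - 1`. -/
def prof (n : ℕ) (f : ℕ → ℕ) : Multiset ℕ :=
  ∑ v ∈ Finset.range n, if f v = 0 then 0 else {f v}

theorem prof_add {n : ℕ} {f g : ℕ → ℕ} (h : Disj f g) : prof n (f + g) = prof n f + prof n g := by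
  rw [prof, prof, prof, ← Finset.sum_add_distrib]
  refine Finset.sum_congr rfl fun v _ => ?_
  rcases h v with h | h <;> simp [h]

theorem prof_zero (n : ℕ) : prof n 0 = 0 := by simp [prof]

theorem prof_single {n v a : ℕ} (hv : v < n) (ha : a ≠ 0) : prof n (Pi.single v a) = {a} := by
  rw [prof, Finset.sum_eq_single v]
  · simp [ha]
  · intro w _ hw
    simp [Pi.single_eq_of_ne hw]
  · intro h
    exact absurd (Finset.mem_range.2 hv) h

theorem card_prof (n : ℕ) (f : ℕ → ℕ) :
    (prof n f).card = ((Finset.range n).filter fun v => f v ≠ 0).card := by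
  rw [prof, Multiset.card_sum, Finset.card_filter]
  refine Finset.sum_congr rfl fun v _ => ?_
  by_cases h : f v = 0 <;> simp [h]

theorem prof_eq_zero {n : ℕ} {f : ℕ → ℕ} (hf : ∀ v, n ≤ v → f v = 0) (h : prof n f = 0) :
    f = 0 := by
  have h1 := card_prof n f
  rw [h, Multiset.card_zero, eq_comm, Finset.card_eq_zero, Finset.filter_eq_empty_iff] at h1
  funext v
  by_cases hv : v < n
  · simpa using h1 (Finset.mem_range.2 hv)
  · exact hf v (by omega)

theorem mem_prof {n a : ℕ} {f : ℕ → ℕ} (h : a ∈ prof n f) : ∃ v < n, f v = a ∧ a ≠ 0 := by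
  obtain ⟨v, hv, ha⟩ := Multiset.mem_sum.1 h
  by_cases h0 : f v = 0
  · simp [h0] at ha
  · simp only [h0, if_false, Multiset.mem_singleton] at ha
    exact ⟨v, Finset.mem_range.1 hv, ha.symm, ha ▸ h0⟩

/-- `f` is a solution: values up to `d`, variables below `n`, and all constraints are satisfied. -/
structure IsSol (A cs : List (ℕ × List ℕ)) (d n : ℕ) (f : ℕ → ℕ) : Prop where
  le : ∀ v, f v ≤ d
  zero_of_le : ∀ v, n ≤ v → f v = 0
  ok : ∀ c ∈ cs, (c.1, c.2.map f) ∈ A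

/-- The constraints are `0`-valid and weakly separable. -/
structure Separable (A cs : List (ℕ × List ℕ)) (d n : ℕ) : Prop where
  scope_lt : ∀ c ∈ cs, ∀ v ∈ c.2, v < n
  zero : ∀ c ∈ cs, (c.1, c.2.map 0) ∈ A
  add : ∀ c ∈ cs, ∀ f g : ℕ → ℕ, (∀ v, f v ≤ d) → (∀ v, g v ≤ d) → Disj f g →
    (c.1, c.2.map f) ∈ A → (c.1, c.2.map g) ∈ A → (c.1, c.2.map (f + g)) ∈ A
  sub : ∀ c ∈ cs, ∀ f g : ℕ → ℕ, (∀ v, f v ≤ d) → (∀ v, g v ≤ d) → Disj f g →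
    (c.1, c.2.map g) ∈ A → (c.1, c.2.map (f + g)) ∈ A → (c.1, c.2.map f) ∈ A

variable {A cs : List (ℕ × List ℕ)} {d n k : ℕ}

theorem IsSol.add {f g : ℕ → ℕ} (hA : Separable A cs d n) (hf : IsSol A cs d n f)
    (hg : IsSol A cs d n g) (h : Disj f g) : IsSol A cs d n (f + g) where
  le v := by
    have h1 := hf.le v
    have h2 := hg.le v
    have := h v
    simp only [Pi.add_apply]
    omega
  zero_of_le v hv := by simp [hf.zero_of_le v hv, hg.zero_of_le v hv]
  ok c hc := hA.add c hc f g hf.le hg.le h (hf.ok c hc) (hg.ok c hc)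

theorem IsSol.sub {f g : ℕ → ℕ} (hA : Separable A cs d n) (hg : IsSol A cs d n g)
    (hfg : IsSol A cs d n (f + g)) (h : Disj f g) : IsSol A cs d n f where
  le v := (Nat.le_add_right _ _).trans (hfg.le v)
  zero_of_le v hv := Nat.eq_zero_of_add_eq_zero_right (hfg.zero_of_le v hv)
  ok c hc := hA.sub c hc f g (fun v => (Nat.le_add_right _ _).trans (hfg.le v)) hg.le h
    (hg.ok c hc) (hfg.ok c hc)

theorem IsSol.zero (hA : Separable A cs d n) : IsSol A cs d n 0 :=
  ⟨by simp, by simp, hA.zero⟩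

/-- A nonzero solution that contains no other nonzero solution. -/
def IsMinSol (A cs : List (ℕ × List ℕ)) (d n : ℕ) (f : ℕ → ℕ) : Prop :=
  IsSol A cs d n f ∧ f ≠ 0 ∧ ∀ g h, Disj g h → f = g + h → IsSol A cs d n g → g ≠ 0 → h = 0

/-- Induction on the size of the support. If `h` is not minimal it splits as `g + h'` with `g` a
solution and both parts nonzero; `h'` is a solution by subtraction. The induction hypothesis splits
`g`, and the remainder of `g` is added to `h'`. -/
theorem IsSol.exists_isMinSol {h : ℕ → ℕ} (hA : Separable A cs d n) (hh : IsSol A cs d n h)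
    (h0 : h ≠ 0) : ∃ m h', Disj m h' ∧ h = m + h' ∧ IsMinSol A cs d n m ∧ IsSol A cs d n h' := by
  induction hN : (prof n h).card using Nat.strong_induction_on generalizing h with
  | _ N ih =>
    by_cases hmin : IsMinSol A cs d n h
    · exact ⟨h, 0, fun _ => .inr rfl, by simp, hmin, .zero hA⟩
    · have : ∃ g h', Disj g h' ∧ h = g + h' ∧ IsSol A cs d n g ∧ g ≠ 0 ∧ h' ≠ 0 := by
        by_contra hcon
        refine hmin ⟨hh, h0, fun g h' hd he hg hg0 => ?_⟩
        by_contra hh'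
        exact hcon ⟨g, h', hd, he, hg, hg0, hh'⟩
      obtain ⟨g, h', hd, rfl, hg, hg0, hh'0⟩ := this
      have hh' : IsSol A cs d n h' := hg.sub hA (by rwa [add_comm]) hd.symm
      have hcard : 0 < (prof n h').card := by
        rw [Multiset.card_pos]
        exact fun h => hh'0 (prof_eq_zero hh'.zero_of_le h)
      obtain ⟨m, g', hd', rfl, hm, hg'⟩ := ih (prof n g).card
        (by rw [← hN, prof_add hd, Multiset.card_add]; omega) hg hg0 rfl
      have hd'' := hd.symm.of_add_right
      exact ⟨m, g' + h', hd'.add_right hd''.1.symm, add_assoc _ _ _, hm,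
        hg'.add hA hh' hd''.2.symm⟩

/-- Pigeonhole: members of `L` that meet `f` do so at distinct points of `s`. -/
theorem exists_disj_of_card_lt {f : ℕ → ℕ} (s : Finset ℕ) (hs : ∀ v, f v ≠ 0 → v ∈ s)
    (L : List (ℕ → ℕ)) (hL : L.Pairwise Disj) (hlt : s.card < L.length) : ∃ g ∈ L, Disj f g := by
  induction L generalizing s f with
  | nil => simp at hlt
  | cons g L ih =>
    by_cases hg : Disj f g
    · exact ⟨g, by simp, hg⟩
    · obtain ⟨v, hv⟩ := not_forall.1 hg
      rw [not_or] at hv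
      rw [List.pairwise_cons] at hL
      -- The point `v` is used up by `g`: the rest of `L` vanishes there, so `f` may be set to zero
      -- at `v`.
      obtain ⟨g', hg', hd⟩ := ih (f := Function.update f v 0) (s.erase v)
        (fun w hw => by
          by_cases hwv : w = v
          · simp [hwv] at hw
          · rw [Function.update_of_ne hwv] at hw
            exact Finset.mem_erase.2 ⟨hwv, hs w hw⟩) hL.2
        (by
          have := Finset.card_erase_lt_of_mem (hs v hv.1)
          rw [List.length_cons] at hlt
          omega)
      refine ⟨g', by simp [hg'], fun w => ?_⟩
      by_cases hwv : w = v
      · subst hwv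
        exact .inr ((hL.1 g' hg' w).resolve_left hv.2)
      · have := hd w
        rwa [Function.update_of_ne hwv] at this

/-! ### Correctness of the search -/

theorem asg_cons (v a : ℕ) (S : List (ℕ × ℕ)) :
    asg ((v, a) :: S) = Function.update (asg S) v a := by
  funext w
  by_cases h : w = v
  · simp [asg, h]
  · simp [asg, h, Function.update_of_ne]

theorem asg_cons_eq_add {v : ℕ} {S : List (ℕ × ℕ)} (h : asg S v = 0) (a : ℕ) :
    asg ((v, a) :: S) = asg S + Pi.single v a := by
  rw [asg_cons]
  funext w
  by_cases hw : w = v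
  · subst hw; simp [h]
  · simp [Function.update_of_ne hw, Pi.single_eq_of_ne hw]

theorem disj_single {f : ℕ → ℕ} {v : ℕ} (h : f v = 0) (a : ℕ) : Disj f (Pi.single v a) := by
  intro w
  by_cases hw : w = v
  · subst hw; exact .inl h
  · exact .inr (Pi.single_eq_of_ne hw _)

theorem sat_eq_true {S : List (ℕ × ℕ)} :
    sat A cs S = true ↔ ∀ c ∈ cs, (c.1, c.2.map (asg S)) ∈ A := by
  simp [sat, holds]

/-- The state `x` is a correct partial assignment for the value list `t` that avoids `U`. -/
structure State.Valid (d n : ℕ) (U t : List ℕ) (x : State) : Prop where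
  mem_vals : ∀ a ∈ x.2, a ∈ vals d
  le : ∀ v, asg x.1 v ≤ d
  avoids : ∀ v, asg x.1 v ≠ 0 → v < n ∧ v ∉ U
  mem_keys : ∀ v, asg x.1 v ≠ 0 → v ∈ x.1.map Prod.fst
  prof_add : prof n (asg x.1) + (x.2 : Multiset ℕ) = t

theorem State.Valid.children {U Z t : List ℕ} {x y : State} (h : x.Valid d n U t)
    (hZ : ∀ v ∈ Z, v < n) (hy : y ∈ children U Z x) : y.Valid d n U t := by
  obtain ⟨v, hv, hv0, hvU, a, ha, rfl⟩ := mem_children.1 hy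
  obtain ⟨ha0, had⟩ := SizeCSP.mem_vals.1 (h.mem_vals a ha)
  refine ⟨fun b hb => h.mem_vals b (List.mem_of_mem_erase hb), fun w => ?_, fun w hw => ?_,
    fun w hw => ?_, ?_⟩
  · rw [asg_cons, Function.update_apply]
    split_ifs
    exacts [had, h.le w]
  · by_cases hwv : w = v
    · rw [hwv]; exact ⟨hZ v hv, hvU⟩
    · rw [asg_cons, Function.update_of_ne hwv] at hw
      exact h.avoids w hw
  · by_cases hwv : w = v
    · simp [hwv]
    · rw [asg_cons, Function.update_of_ne hwv] at hw
      exact List.mem_cons_of_mem _ (h.mem_keys w hw)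
  · rw [asg_cons_eq_add hv0, SizeCSP.prof_add (disj_single hv0 a), prof_single (hZ v hv) ha0.ne',
      ← h.prof_add, add_assoc, Multiset.singleton_add, ← Multiset.coe_erase,
      Multiset.cons_erase (by simpa using ha)]

theorem State.Valid.nil {U t : List ℕ} (ht : ∀ a ∈ t, a ∈ vals d) : State.Valid d n U t ([], t) :=
  ⟨ht, by simp [asg], by simp [asg], by simp [asg],
    by rw [show asg [] = 0 from rfl, prof_zero, zero_add]⟩

theorem length_snd_of_mem_children {U Z : List ℕ} {x y : State} (hy : y ∈ children U Z x) :
    y.2.length + 1 = x.2.length := by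
  obtain ⟨v, -, -, -, a, ha, rfl⟩ := mem_children.1 hy
  have := List.length_pos_of_mem ha
  rw [List.length_erase_of_mem ha]
  omega

/-- Soundness of the search. Each round consumes one value, so after as many rounds as there are
values none is left. -/
theorem valid_of_mem_search {U W t t' : List ℕ} {Q : List State} (hA : Separable A cs d n)
    (hW : ∀ v ∈ W, v < n) (hQ : ∀ x ∈ Q, x.Valid d n U t ∧ x.2.length = t'.length) :
    ∀ x ∈ search A cs U W Q t', x.Valid d n U t ∧ x.2 = [] := by
  induction t' generalizing Q with
  | nil => exact fun x hx => ⟨(hQ x hx).1, by simpa using (hQ x hx).2⟩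
  | cons a t' ih =>
    refine ih fun y hy => ?_
    obtain ⟨x, hx, hy⟩ := List.mem_flatMap.1 hy
    have h1 := length_snd_of_mem_children hy
    rw [(hQ x hx).2, List.length_cons] at h1
    exact ⟨(hQ x hx).1.children (cand_lt hW hA.scope_lt) hy, by omega⟩

theorem State.Valid.isSol {U t : List ℕ} {x : State} (h : x.Valid d n U t) (h' : x.2 = [])
    (hs : sat A cs x.1 = true) : IsSol A cs d n (asg x.1) ∧ prof n (asg x.1) = t := by
  refine ⟨⟨h.le, fun v hv => ?_, sat_eq_true.1 hs⟩, ?_⟩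
  · by_contra h0
    have := (h.avoids v h0).1
    omega
  · rw [← h.prof_add, h']
    simp

/-! ### Completeness of the branching. -/

/-- The state `x` can be completed to `f`. -/
def State.ExtendsTo (n : ℕ) (f : ℕ → ℕ) (x : State) : Prop :=
  ∃ h, Disj (asg x.1) h ∧ f = asg x.1 + h ∧ prof n h = x.2

/-- The right child gives `v` the value `h v`; what remains to be added is `h` with this point
removed. -/
theorem exists_mem_children {U Z : List ℕ} {x : State} {h : ℕ → ℕ} {v : ℕ}
    (hd : Disj (asg x.1) h) (hh : prof n h = x.2) (hv : v ∈ Z) (hvn : v < n) (hvU : v ∉ U)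
    (hhv : h v ≠ 0) : ∃ y ∈ children U Z x, y.ExtendsTo n (asg x.1 + h) ∧ asg y.1 ≠ 0 := by
  have hv0 : asg x.1 v = 0 := (hd v).resolve_right hhv
  have heq : h = Pi.single v (h v) + Function.update h v 0 := by
    funext w
    by_cases hw : w = v
    · subst hw; simp
    · simp [Pi.single_eq_of_ne hw, Function.update_of_ne hw]
  have hd' : Disj (Pi.single v (h v)) (Function.update h v 0) :=
    (disj_single (by simp) _).symm
  have hprof : (x.2 : Multiset ℕ) = {h v} + prof n (Function.update h v 0) := by
    rw [← hh, ← prof_single hvn hhv, ← prof_add hd', ← heq]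
  have hmem : h v ∈ x.2 := by
    rw [← Multiset.mem_coe, hprof]; simp
  refine ⟨((v, h v) :: x.1, x.2.erase (h v)), mem_children.2 ⟨v, hv, hv0, hvU, h v, hmem, rfl⟩,
    ⟨Function.update h v 0, fun w => ?_, ?_, ?_⟩, fun h0 => hhv ?_⟩
  · by_cases hw : w = v
    · subst hw; simp
    · rw [asg_cons, Function.update_of_ne hw, Function.update_of_ne hw]
      exact hd w
  · rw [asg_cons_eq_add hv0, add_assoc, ← heq]
  · rw [← Multiset.coe_erase, hprof, Multiset.singleton_add, Multiset.erase_cons_head]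
  · simpa [asg_cons] using congrFun h0 v

/-- If the missing part `h` vanished on the scope of the violated constraint, the solution `f` and
the partial assignment would agree there, and `f` would violate it too. -/
theorem exists_mem_expand_of_not_sat {U W : List ℕ} {x : State} {f : ℕ → ℕ}
    (hA : Separable A cs d n) (hf : IsSol A cs d n f) (hx : x.ExtendsTo n f)
    (hU : ∀ v ∈ U, f v = 0) (hs : sat A cs x.1 ≠ true) :
    ∃ y ∈ expand A cs U W x, y.ExtendsTo n f ∧ asg y.1 ≠ 0 := by
  obtain ⟨h, hd, rfl, hh⟩ := hx
  obtain ⟨c, hc, hviol, hcand⟩ := (cand_eq A cs W x.1).resolve_left fun h => hs h.1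
  have : ∃ v ∈ c.2, h v ≠ 0 := by
    by_contra hcon
    push Not at hcon
    have h1 := hf.ok c hc
    rw [List.map_congr_left (g := asg x.1) fun v hv => by simp [hcon v hv]] at h1
    simp [holds, h1] at hviol
  obtain ⟨v, hv, hhv⟩ := this
  rw [expand, hcand]
  refine exists_mem_children hd hh hv (hA.scope_lt c hc v hv) (fun hvU => hhv ?_) hhv
  exact Nat.eq_zero_of_add_eq_zero_left (hU v hvU)

/-- The property `G` need not name a fixed target: the greedy search follows one minimal solution,
whereas the main search changes its target on the way. -/
theorem exists_mem_search {U W t : List ℕ} {Q : List State} (G : State → Prop)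
    (hG : ∀ x, G x → x.2 ≠ [] → ∃ y ∈ expand A cs U W x, G y) {x : State} (hx : x ∈ Q) (hGx : G x)
    (ht : x.2.length = t.length) : ∃ y ∈ search A cs U W Q t, G y ∧ y.2 = [] := by
  induction t generalizing Q x with
  | nil => exact ⟨x, hx, hGx, by simpa using ht⟩
  | cons a t ih =>
    rw [List.length_cons] at ht
    obtain ⟨y, hy, hGy⟩ := hG x hGx (by rintro h; simp [h] at ht)
    have := length_snd_of_mem_children hy
    exact ih (List.mem_flatMap.2 ⟨x, hx, hy⟩) hGy (by omega)

theorem State.ExtendsTo.asg_eq {f : ℕ → ℕ} {x : State} (hf : ∀ v, n ≤ v → f v = 0)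
    (h : x.ExtendsTo n f) (hx : x.2 = []) : asg x.1 = f := by
  obtain ⟨h, hd, rfl, hh⟩ := h
  rw [hx, Multiset.coe_nil] at hh
  rw [prof_eq_zero (fun v hv => Nat.eq_zero_of_add_eq_zero_left (hf v hv)) hh, add_zero]

/-- If some minimal solution of type `t` avoids `W`, the search follows it to the end, so some
solution is found; the one found need not be minimal. -/
theorem greedyStep_spec {W t : List ℕ} (hA : Separable A cs d n) (ht : ∀ a ∈ t, a ∈ vals d) :
    (∀ v ∈ W, v ∈ greedyStep A n cs W t) ∧
    ((∀ f, IsMinSol A cs d n f → prof n f = t → ∃ v ∈ W, f v ≠ 0) ∨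
      ∃ f, IsSol A cs d n f ∧ prof n f = t ∧ (∀ v ∈ W, f v = 0) ∧
        ∀ v, f v ≠ 0 → v ∈ greedyStep A n cs W t) := by
  rcases greedyStep_eq A n cs W t with ⟨h, hunsat⟩ | ⟨x, hx, hsat, h⟩
  · rw [h]
    refine ⟨fun v hv => hv, .inl fun f hf hft => ?_⟩
    by_contra hcon
    push Not at hcon
    obtain ⟨v, hv⟩ : ∃ v, f v ≠ 0 := by
      by_contra h0
      push Not at h0
      exact hf.2.1 (funext h0)
    have hvn : v < n := by
      by_contra hle
      exact hv (hf.1.zero_of_le v (by omega))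
    obtain ⟨x, hx, hxf, hx0⟩ := exists_mem_children (n := n) (U := W) (Z := vars n) (x := ([], t))
      (h := f) (v := v) (fun _ => .inl rfl) hft (mem_vars.2 hvn) hvn (fun h => hv (hcon v h)) hv
    rw [show asg ([], t).1 + f = f from zero_add f] at hxf
    obtain ⟨y, hy, ⟨hyf, -⟩, hy2⟩ := exists_mem_search (A := A) (cs := cs) (U := W) (W := [])
      (t := t.tail) (fun x => x.ExtendsTo n f ∧ asg x.1 ≠ 0)
      (by
        rintro x ⟨hxf, hx0⟩ hx2
        -- A satisfying partial assignment would be a nonzero solution inside the minimal `f`, hence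
        -- all of `f`, and no value would remain.
        refine exists_mem_expand_of_not_sat hA hf.1 hxf hcon fun hs => hx2 ?_
        obtain ⟨h, hd, hfh, hh⟩ := hxf
        have h0 := hf.2.2 _ h hd hfh ⟨fun v => ?_, fun v hv => ?_, sat_eq_true.1 hs⟩ hx0
        · rw [h0, prof_zero, eq_comm, Multiset.coe_eq_zero] at hh
          exact hh
        · exact (Nat.le_add_right _ _).trans (hfh ▸ hf.1.le v)
        · exact Nat.eq_zero_of_add_eq_zero_right (hfh ▸ hf.1.zero_of_le v hv)) hx ⟨hxf, hx0⟩
      (by have := length_snd_of_mem_children hx; simp at this ⊢; omega)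
    have hys := hunsat y hy
    have : sat A cs y.1 = true := by
      rw [sat_eq_true, hyf.asg_eq hf.1.zero_of_le hy2]
      exact hf.1.ok
    rw [this] at hys
    cases hys
  · obtain ⟨hval, hx2⟩ := valid_of_mem_search (t := t) hA (by simp) (fun y hy =>
      ⟨(State.Valid.nil ht).children (fun v hv => mem_vars.1 hv) hy, by
        have := length_snd_of_mem_children hy; simp at this ⊢; omega⟩) x hx
    obtain ⟨h1, h2⟩ := hval.isSol hx2 hsat
    rw [h]
    refine ⟨fun v hv => List.mem_append_right _ hv, .inr ⟨_, h1, h2, fun v hv => ?_, fun v hv =>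
      List.mem_append_left _ (hval.mem_keys v hv)⟩⟩
    by_contra h0
    exact (hval.avoids v h0).2 hv

/-! ### Hitting or packing, and the exchange argument. -/

/-- Every minimal solution with value list `t` meets `W`, or there are `m` disjoint solutions with
value list `t` within `W`. -/
def HitOrPacked (A cs : List (ℕ × List ℕ)) (d n m : ℕ) (W t : List ℕ) : Prop :=
  (∀ f, IsMinSol A cs d n f → prof n f = t → ∃ v ∈ W, f v ≠ 0) ∨
    ∃ L : List (ℕ → ℕ), L.length = m ∧ L.Pairwise Disj ∧
      ∀ f ∈ L, IsSol A cs d n f ∧ prof n f = t ∧ ∀ v, f v ≠ 0 → v ∈ W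

theorem HitOrPacked.mono {m : ℕ} {W W' t : List ℕ} (h : HitOrPacked A cs d n m W t)
    (hW : ∀ v ∈ W, v ∈ W') : HitOrPacked A cs d n m W' t := by
  rcases h with h | ⟨L, h1, h2, h3⟩
  · refine .inl fun f hf hft => ?_
    obtain ⟨v, hv, hfv⟩ := h f hf hft
    exact ⟨v, hW v hv, hfv⟩
  · exact .inr ⟨L, h1, h2, fun f hf => ⟨(h3 f hf).1, (h3 f hf).2.1, fun v hv =>
      hW v ((h3 f hf).2.2 v hv)⟩⟩

theorem subset_foldl_greedyStep (hA : Separable A cs d n) (L : List (List ℕ))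
    (hL : ∀ t ∈ L, ∀ a ∈ t, a ∈ vals d) (W : List ℕ) :
    ∀ v ∈ W, v ∈ L.foldl (greedyStep A n cs) W := by
  induction L generalizing W with
  | nil => exact fun v hv => hv
  | cons t L ih =>
    exact fun v hv => ih (fun t ht => hL t (by simp [ht])) _ v
      ((greedyStep_spec hA (hL t (by simp))).1 v hv)

/-- If every minimal solution is hit at some stage, this persists as the set grows. Otherwise every
round finds a solution avoiding the earlier ones. Recording that the solutions in `L` vanish on the
initial `W` is what makes the induction yield disjointness. -/
theorem foldl_greedyStep_replicate {t : List ℕ} (hA : Separable A cs d n)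
    (ht : ∀ a ∈ t, a ∈ vals d) (m : ℕ) (W : List ℕ) :
    (∀ f, IsMinSol A cs d n f → prof n f = t →
        ∃ v ∈ (List.replicate m t).foldl (greedyStep A n cs) W, f v ≠ 0) ∨
      ∃ L : List (ℕ → ℕ), L.length = m ∧ L.Pairwise Disj ∧
        ∀ f ∈ L, IsSol A cs d n f ∧ prof n f = t ∧ (∀ v ∈ W, f v = 0) ∧
          ∀ v, f v ≠ 0 → v ∈ (List.replicate m t).foldl (greedyStep A n cs) W := by
  induction m generalizing W with
  | zero => exact .inr ⟨[], rfl, .nil, by simp⟩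
  | succ m ih =>
    obtain ⟨hsub, hspec⟩ := greedyStep_spec (W := W) hA ht
    have hsub' := subset_foldl_greedyStep hA (List.replicate m t)
      (fun s hs => by rwa [List.eq_of_mem_replicate hs]) (greedyStep A n cs W t)
    rw [List.replicate_succ, List.foldl_cons]
    rcases ih (greedyStep A n cs W t) with h | ⟨L, h1, h2, h3⟩
    · exact .inl h
    · rcases hspec with h | ⟨f, hf, hft, hfW, hfs⟩
      · refine .inl fun f hf hft => ?_
        obtain ⟨v, hv, hfv⟩ := h f hf hft
        exact ⟨v, hsub' v (hsub v hv), hfv⟩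
      · refine .inr ⟨f :: L, by simp [h1], List.pairwise_cons.2 ⟨fun g hg v => ?_, h2⟩, ?_⟩
        · by_cases hfv : f v = 0
          · exact .inl hfv
          · exact .inr ((h3 g hg).2.2.1 v (hfs v hfv))
        · simp only [List.mem_cons, forall_eq_or_imp]
          exact ⟨⟨hf, hft, hfW, fun v hv => hsub' v (hfs v hv)⟩, fun g hg => ⟨(h3 g hg).1,
            (h3 g hg).2.1, fun v hv => (h3 g hg).2.2.1 v (hsub v hv), (h3 g hg).2.2.2⟩⟩

/-- The rounds for `t` are consecutive. Earlier rounds only determine the set they start from, and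
later ones only enlarge it. -/
theorem hitOrPacked_hubs {t : List ℕ} (hA : Separable A cs d n) (ht : t ∈ types d k) :
    HitOrPacked A cs d n (k + 1) (hubs A d n cs k) t := by
  have hT : ∀ s ∈ types d k, ∀ a ∈ s, a ∈ vals d := fun s hs => (mem_types.1 hs).2
  obtain ⟨l₁, l₂, hl⟩ := List.append_of_mem ht
  have hr : ∀ l : List (List ℕ), (∀ s ∈ l, s ∈ types d k) →
      ∀ s ∈ l.flatMap fun s => (List.replicate (k + 1) ()).map fun _ => s, ∀ a ∈ s, a ∈ vals d := by
    intro l hl s hs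
    obtain ⟨s', hs', h⟩ := List.mem_flatMap.1 hs
    obtain ⟨-, -, rfl⟩ := List.mem_map.1 h
    exact hT s' (hl s' hs')
  have h : HitOrPacked A cs d n (k + 1) ((List.replicate (k + 1) t).foldl (greedyStep A n cs)
      ((l₁.flatMap fun s => (List.replicate (k + 1) ()).map fun _ => s).foldl
        (greedyStep A n cs) [])) t := by
    rcases foldl_greedyStep_replicate hA (hT t ht) (k + 1) _ with h | ⟨L, h1, h2, h3⟩
    · exact .inl h
    · exact .inr ⟨L, h1, h2, fun f hf => ⟨(h3 f hf).1, (h3 f hf).2.1, (h3 f hf).2.2.2⟩⟩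
  rw [hubs, hl, List.flatMap_append, List.flatMap_cons, List.foldl_append, List.foldl_append,
    List.map_replicate]
  exact h.mono (subset_foldl_greedyStep hA _ (hr l₂ fun s hs => by rw [hl]; simp [hs]) _)

/-- If a constraint is violated, the target is kept. Otherwise a minimal part `m` of the rest either
meets the hubs or can be exchanged for a packed solution with the same values. -/
theorem exists_mem_expand_hubs {x : State} {f : ℕ → ℕ} (hA : Separable A cs d n)
    (hf : IsSol A cs d n f) (hk : (prof n f).card ≤ k) (hx : x.ExtendsTo n f) (hx2 : x.2 ≠ []) :
    ∃ y ∈ expand A cs [] (hubs A d n cs k) x, ∃ f', IsSol A cs d n f' ∧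
      (prof n f').card ≤ k ∧ y.ExtendsTo n f' := by
  by_cases hs : sat A cs x.1 = true
  swap
  · obtain ⟨y, hy, hyf, -⟩ := exists_mem_expand_of_not_sat (W := hubs A d n cs k) hA hf hx
      (U := []) (by simp) hs
    exact ⟨y, hy, f, hf, hk, hyf⟩
  obtain ⟨h, hd, rfl, hh⟩ := hx
  have hlt : ∀ v ∈ hubs A d n cs k, v < n := hubs_lt hA.scope_lt
  have hcand : cand A cs (hubs A d n cs k) x.1 = hubs A d n cs k := by
    rcases cand_eq A cs (hubs A d n cs k) x.1 with h | ⟨c, hc, hviol, -⟩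
    · exact h.2
    · have := List.all_eq_true.1 hs c hc
      rw [hviol] at this
      cases this
  have hS : IsSol A cs d n (asg x.1) :=
    ⟨fun v => (Nat.le_add_right _ _).trans (hf.le v),
      fun v hv => Nat.eq_zero_of_add_eq_zero_right (hf.zero_of_le v hv), sat_eq_true.1 hs⟩
  have hhsol : IsSol A cs d n h := hS.sub hA (by rwa [add_comm]) hd.symm
  have hh0 : h ≠ 0 := by
    rintro rfl
    rw [prof_zero, eq_comm, Multiset.coe_eq_zero] at hh
    exact hx2 hh
  obtain ⟨m, h', hmd, rfl, hm, hh'⟩ := hhsol.exists_isMinSol hA hh0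
  have hmk : (prof n m).card ≤ k := by
    rw [prof_add hd, prof_add hmd, Multiset.card_add, Multiset.card_add] at hk
    omega
  have hmt : (prof n m).toList ∈ types d k := by
    refine mem_types.2 ⟨by simpa using hmk, fun a ha => ?_⟩
    obtain ⟨v, -, rfl, h0⟩ := mem_prof (Multiset.mem_toList.1 ha)
    exact mem_vals.2 ⟨Nat.pos_of_ne_zero h0, hm.1.le v⟩
  rw [expand, hcand]
  rcases hitOrPacked_hubs hA hmt with hhit | ⟨L, hL, hLd, hLs⟩
  · obtain ⟨v, hv, hmv⟩ := hhit m hm (by simp)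
    obtain ⟨y, hy, hyf, -⟩ := exists_mem_children (n := n) (U := []) hd hh hv (hlt v hv)
      (by simp) (by simp only [Pi.add_apply]; omega)
    exact ⟨y, hy, _, hf, hk, hyf⟩
  -- The packing has `k + 1` members and the support of the target at most `k` elements, so some `g`
  -- avoids the target altogether.
  · obtain ⟨g, hgL, hg⟩ := exists_disj_of_card_lt
      (f := asg x.1 + (m + h')) ((Finset.range n).filter fun v => (asg x.1 + (m + h')) v ≠ 0)
      (fun v hv => by
        rw [Finset.mem_filter, Finset.mem_range]
        refine ⟨?_, hv⟩
        by_contra hle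
        exact hv (hf.zero_of_le v (by omega))) L hLd (by rw [← card_prof, hL]; omega)
    obtain ⟨hgs, hgt, hgW⟩ := hLs g hgL
    rw [Multiset.coe_toList] at hgt
    obtain ⟨hgS, hgm⟩ := hg.symm.of_add_right
    have hgh' := hgm.of_add_right.2
    have hd' : Disj (asg x.1) (g + h') := hgS.symm.add_right hd.of_add_right.2
    have hprof : prof n (g + h') = prof n (m + h') := by
      rw [prof_add hgh', prof_add hmd, hgt]
    obtain ⟨v, hv⟩ : ∃ v, g v ≠ 0 := by
      by_contra h0
      push Not at h0
      rw [show g = 0 from funext h0, prof_zero] at hgt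
      exact hm.2.1 (prof_eq_zero hm.1.zero_of_le hgt.symm)
    obtain ⟨y, hy, hyf, -⟩ := exists_mem_children (n := n) (U := []) hd' (hprof.trans hh)
      (hgW v hv) (hlt v (hgW v hv)) (by simp) (by simp only [Pi.add_apply]; omega)
    -- The new target replaces `m` by `g`; its profile is unchanged, so the bound `k` persists.
    refine ⟨y, hy, _, hS.add hA (hgs.add hA hh' hgh') hd', ?_, hyf⟩
    rw [prof_add hd', hprof, ← prof_add hd]
    exact hk

/-- Exchanges alter the target, so completeness only maintains that some solution extends the state.
That the values are exactly those of `t` is tracked separately by `State.Valid`. -/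
theorem solve_eq_true (hA : Separable A cs d n) {T : List (List ℕ)}
    (hT : ∀ t ∈ T, t ∈ types d k) :
    solve A d n cs k T = true ↔ ∃ t ∈ T, ∃ f, IsSol A cs d n f ∧ prof n f = t := by
  simp only [solve, List.any_eq_true]
  refine exists_congr fun t => and_congr_right fun ht => ?_
  obtain ⟨htk, htd⟩ := mem_types.1 (hT t ht)
  constructor
  · rintro ⟨x, hx, hs⟩
    obtain ⟨hval, hx2⟩ := valid_of_mem_search (t := t) hA (hubs_lt hA.scope_lt)
      (by simpa using State.Valid.nil htd) x hx
    exact ⟨_, hval.isSol hx2 hs⟩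
  · rintro ⟨f, hf, hft⟩
    obtain ⟨y, hy, ⟨f', hf', -, hyf⟩, hy2⟩ := exists_mem_search (A := A) (cs := cs) (U := [])
      (W := hubs A d n cs k) (t := t) (Q := [([], t)]) (x := ([], t))
      (fun x => ∃ f', IsSol A cs d n f' ∧ (prof n f').card ≤ k ∧ x.ExtendsTo n f')
      (fun x ⟨f', h1, h2, h3⟩ hx2 => exists_mem_expand_hubs hA h1 h2 h3 hx2) (by simp)
      ⟨f, hf, by rw [hft]; simpa using htk, f, fun _ => .inl rfl, (zero_add f).symm, hft⟩ rfl
    refine ⟨y, hy, ?_⟩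
    rw [sat_eq_true, hyf.asg_eq hf'.zero_of_le hy2]
    exact hf'.ok

end SizeCSP
namespace SizeCSP

open Enc

/-! ### Values and relations as natural numbers -/

section Values

variable {D : Type*} [Zero D] {d : ℕ} (valEnum : Fin d ≃ {a : D // a ≠ 0})

/-- The value with the given number. -/
def valOf (i : ℕ) : D :=
  if h : 0 < i ∧ i ≤ d then (valEnum ⟨i - 1, by omega⟩).1 else 0

open Classical in
/-- The number of a value. -/
noncomputable def idxOf (a : D) : ℕ :=
  if h : a ≠ 0 then (valEnum.symm ⟨a, h⟩ : ℕ) + 1 else 0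

theorem valOf_zero : valOf valEnum 0 = 0 := by simp [valOf]

theorem idxOf_le (a : D) : idxOf valEnum a ≤ d := by
  unfold idxOf
  split_ifs with h
  · have := (valEnum.symm ⟨a, h⟩).2
    omega
  · omega

theorem valOf_idxOf (a : D) : valOf valEnum (idxOf valEnum a) = a := by
  unfold idxOf
  split_ifs with h
  · have := (valEnum.symm ⟨a, h⟩).2
    rw [valOf, dif_pos ⟨by omega, by omega⟩]
    simp
  · rw [valOf_zero, not_not.1 h]

theorem idxOf_valOf {i : ℕ} (hi : i ≤ d) : idxOf valEnum (valOf valEnum i) = i := by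
  unfold valOf
  split_ifs with h
  · rw [idxOf, dif_pos (valEnum _).2]
    simp only [Subtype.coe_eta, Equiv.symm_apply_apply]
    omega
  · rw [idxOf, dif_neg (by simp)]
    omega

theorem idxOf_eq_iff {i : ℕ} (hi : i ≤ d) (a : D) :
    idxOf valEnum a = i ↔ a = valOf valEnum i := by
  constructor
  · rintro rfl
    rw [valOf_idxOf]
  · rintro rfl
    exact idxOf_valOf valEnum hi

theorem idxOf_eq_zero (a : D) : idxOf valEnum a = 0 ↔ a = 0 := by
  rw [idxOf_eq_iff valEnum (Nat.zero_le d), valOf_zero]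

theorem valOf_eq_zero {i : ℕ} (hi : i ≤ d) : valOf valEnum i = 0 ↔ i = 0 := by
  rw [← idxOf_eq_zero valEnum, idxOf_valOf valEnum hi]

theorem valOf_succ (i : Fin d) : valOf valEnum (i + 1) = (valEnum i).1 := by
  rw [valOf, dif_pos ⟨by omega, by omega⟩]
  rfl

/-- At each coordinate one number is zero, so adding numbers realizes the union of tuples. -/
theorem unionTuple_valOf {r : ℕ} {f g : Fin r → ℕ} (hf : ∀ i, f i ≤ d)
    (h : ∀ i, f i = 0 ∨ g i = 0) :
    unionTuple (fun i => valOf valEnum (f i)) (fun i => valOf valEnum (g i)) =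
      fun i => valOf valEnum (f i + g i) := by
  funext i
  by_cases h0 : f i = 0
  · simp [unionTuple, h0, valOf_zero]
  · have h1 := (h i).resolve_left h0
    simp [unionTuple, valOf_eq_zero valEnum (hf i), h0, h1]

end Values

section Coding

variable {D : Type*} {Γ : Set (Rel D)} (relCode : Γ → ℕ)

/-- A constraint, given by numbers. -/
def Constraint.code {n : ℕ} (C : Constraint Γ n) : ℕ × List ℕ :=
  (relCode C.rel, List.ofFn fun i => (C.scope i : ℕ))

/-- The constraints of an instance, given by numbers. -/
def Instance.codes (I : Instance Γ) : List (ℕ × List ℕ) :=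
  I.constraints.map (Constraint.code relCode)

/-- The numerical form has literally the same tree as the instance, so the input needs no
conversion. -/
theorem Instance.enc_codes (I : Instance Γ) :
    enc (I.numVars, I.codes relCode) = I.encode relCode := by
  refine congrArg (Data.cons _) ?_
  change Data.ofList ((I.constraints.map (Constraint.code relCode)).map enc) = _
  rw [List.map_map]
  congr 1
  refine List.map_congr_left fun C _ => ?_
  refine congrArg (Data.cons _) ?_
  change Data.ofList ((List.ofFn fun i => (C.scope i : ℕ)).map enc) = _
  rw [List.map_ofFn]
  rfl

variable {relCode} in
theorem fptCSP_codes {J : Type*} {ε : Type*} [Enc ε] (inst : J → Instance Γ) (k : J → ℕ)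
    {e : J → ε} {r : ℕ} (hr : ∀ R ∈ Γ, R.arity ≤ r)
    (he : Fpt (fun j => (k j, (inst j).size)) e fun j => ((inst j).numVars, (inst j).codes relCode))
    (hk : Fpt (fun j => (k j, (inst j).size)) e k) :
    FptCSP (fun j => (k j, (inst j).size)) e r (fun j => (inst j).numVars)
      (fun j => (inst j).codes relCode) k where
  fpt_n := he.fst
  bd_n := Bd.size.mono fun j => Nat.le_add_right _ _
  fpt_cs := he.snd
  bd_cs := Bd.size.mono fun j => by
    rw [Instance.codes, List.length_map]
    refine le_trans ?_ (Nat.le_add_left _ _)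
    -- Each constraint contributes at least 1 to the size, even in arity zero.
    induction (inst j).constraints with
    | nil => simp
    | cons C l ih => simp only [List.length_cons, List.map_cons, List.sum_cons]; omega
  fpt_k := hk
  bd_k := BdK.param
  length_scope j c hc := by
    obtain ⟨C, -, rfl⟩ := List.mem_map.1 hc
    simpa [Constraint.code] using hr _ C.rel.2
  scope_lt j c hc v hv := by
    obtain ⟨C, -, rfl⟩ := List.mem_map.1 hc
    obtain ⟨i, rfl⟩ := (List.mem_ofFn' _ _).1 hv
    exact (C.scope i).2

end Coding

section Language

variable {D : Type*} [Zero D] {Γ : Set (Rel D)} {relCode : Γ → ℕ} {d : ℕ}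
  (valEnum : Fin d ≃ {a : D // a ≠ 0})

/-- The pairs of a code and a tuple in the relation with this code. -/
def allowed (relCode : Γ → ℕ) : Set (ℕ × List ℕ) :=
  {x | ∃ R : Γ, ∃ t ∈ R.1.tuples, x = (relCode R, List.ofFn fun i => idxOf valEnum (t i))}

/-- Finiteness of `D` and `Γ` makes all relations together a finite table, which is built into the
program as a constant. -/
theorem exists_list_allowed [Finite D] (hfin : Γ.Finite) (relCode : Γ → ℕ) :
    ∃ A : List (ℕ × List ℕ), ∀ x, x ∈ A ↔ x ∈ allowed valEnum relCode := by
  have := hfin.to_subtype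
  have h : (allowed valEnum relCode).Finite := by
    refine (Set.finite_range fun x : Σ R : Γ, Fin R.1.arity → D =>
      (relCode x.1, List.ofFn fun i => idxOf valEnum (x.2 i))).subset ?_
    rintro x ⟨R, t, -, rfl⟩
    exact ⟨⟨R, t⟩, rfl⟩
  exact ⟨h.toFinset.toList, by simp⟩

theorem mem_allowed (hcode : Function.Injective relCode) {n : ℕ} (C : Constraint Γ n)
    {f : ℕ → ℕ} (hf : ∀ v, f v ≤ d) :
    ((C.code relCode).1, (C.code relCode).2.map f) ∈ allowed valEnum relCode ↔
      (fun i => valOf valEnum (f (C.scope i))) ∈ C.rel.1.tuples := by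
  simp only [Constraint.code, List.map_ofFn]
  constructor
  · rintro ⟨R, t, ht, h⟩
    rw [Prod.mk.injEq] at h
    obtain rfl := hcode h.1
    convert ht using 1
    funext i
    have := congrFun (List.ofFn_injective h.2) i
    simp only [Function.comp_apply] at this
    rw [this, valOf_idxOf]
  · intro h
    refine ⟨C.rel, _, h, ?_⟩
    rw [Prod.mk.injEq]
    exact ⟨rfl, congrArg _ (funext fun i => (idxOf_valOf valEnum (hf _)).symm)⟩

theorem separable_codes (hcode : Function.Injective relCode) (hzero : ∀ R ∈ Γ, R.ZeroValid)
    (hws : WeaklySeparable Γ) (I : Instance Γ) (A : List (ℕ × List ℕ))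
    (hA : ∀ x, x ∈ A ↔ x ∈ allowed valEnum relCode) :
    Separable A (I.codes relCode) d I.numVars := by
  constructor
  · intro c hc v hv
    obtain ⟨C, -, rfl⟩ := List.mem_map.1 hc
    obtain ⟨i, rfl⟩ := (List.mem_ofFn' _ _).1 hv
    exact (C.scope i).2
  · intro c hc
    obtain ⟨C, -, rfl⟩ := List.mem_map.1 hc
    rw [hA, mem_allowed valEnum hcode C (by simp)]
    simp only [Pi.zero_apply, valOf_zero]
    exact hzero _ C.rel.2
  · intro c hc f g hf hg hd h1 h2
    obtain ⟨C, -, rfl⟩ := List.mem_map.1 hc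
    have hfg : ∀ v, (f + g) v ≤ d := fun v => by
      have := hd v; have := hf v; have := hg v; simp only [Pi.add_apply]; omega
    rw [hA, mem_allowed valEnum hcode C hf] at h1
    rw [hA, mem_allowed valEnum hcode C hg] at h2
    rw [hA, mem_allowed valEnum hcode C hfg]
    have := (hws _ C.rel.2).1 _ _ (fun i => ?_) h1 h2
    · rwa [unionTuple_valOf valEnum (fun i => hf _) fun i => hd _] at this
    · simpa [valOf_eq_zero valEnum, hf, hg] using hd (C.scope i)
  · intro c hc f g hf hg hd h1 h2
    obtain ⟨C, -, rfl⟩ := List.mem_map.1 hc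
    have hfg : ∀ v, (f + g) v ≤ d := fun v => by
      have := hd v; have := hf v; have := hg v; simp only [Pi.add_apply]; omega
    rw [hA, mem_allowed valEnum hcode C hg] at h1
    rw [hA, mem_allowed valEnum hcode C hfg] at h2
    rw [hA, mem_allowed valEnum hcode C hf]
    refine (hws _ C.rel.2).2 _ _ (fun i => ?_) h1 ?_
    · simpa [valOf_eq_zero valEnum, hf, hg] using hd (C.scope i)
    · rwa [unionTuple_valOf valEnum (fun i => hf _) fun i => hd _]

theorem ncard_fin_eq {n : ℕ} (p : ℕ → Prop) [DecidablePred p] :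
    {v : Fin n | p v}.ncard = ((Finset.range n).filter p).card := by
  rw [← Set.ncard_coe_finset, ← Set.ncard_image_of_injective _ Fin.val_injective]
  congr 1
  ext v
  simp only [Set.mem_image, Set.mem_ofPred_eq, Finset.coe_filter, Finset.mem_range]
  constructor
  · rintro ⟨w, hw, rfl⟩
    exact ⟨w.2, hw⟩
  · rintro ⟨hv, hp⟩
    exact ⟨⟨v, hv⟩, hp, rfl⟩

theorem count_prof {n a : ℕ} (ha : a ≠ 0) (f : ℕ → ℕ) :
    (prof n f).count a = ((Finset.range n).filter fun v => f v = a).card := by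
  rw [prof, Multiset.count_sum', Finset.card_filter]
  refine Finset.sum_congr rfl fun v _ => ?_
  by_cases h : f v = 0
  · rw [if_pos h, Multiset.count_zero, if_neg (by omega)]
  · rw [if_neg h, Multiset.count_singleton]
    simp only [eq_comm]

/-- Satisfying assignments and solutions given by numbers correspond to each other. -/
theorem exists_satisfies_iff (hcode : Function.Injective relCode) (I : Instance Γ)
    {A : List (ℕ × List ℕ)} (hA : ∀ x, x ∈ A ↔ x ∈ allowed valEnum relCode)
    (p : ℕ → (Fin d → ℕ) → Prop) :
    (∃ τ : Fin I.numVars → D, I.Satisfies τ ∧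
      p (assignmentSize τ) fun i => {v | τ v = (valEnum i).1}.ncard) ↔
    ∃ f, IsSol A (I.codes relCode) d I.numVars f ∧
      p (prof I.numVars f).card fun i => (prof I.numVars f).count ((i : ℕ) + 1) := by
  have key : ∀ (τ : Fin I.numVars → D) (f : ℕ → ℕ), (∀ v, f v ≤ d) →
      (∀ v : Fin I.numVars, τ v = valOf valEnum (f v)) →
      (I.Satisfies τ ↔ ∀ c ∈ I.codes relCode, (c.1, c.2.map f) ∈ A) ∧
      assignmentSize τ = (prof I.numVars f).card ∧
      (fun i => {v | τ v = (valEnum i).1}.ncard) =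
        fun i : Fin d => (prof I.numVars f).count ((i : ℕ) + 1) := by
    intro τ f hf hτ
    refine ⟨?_, ?_, funext fun i => ?_⟩
    · simp only [Instance.codes, List.forall_mem_map, hA, mem_allowed valEnum hcode _ hf,
        Instance.Satisfies, hτ]
    · simp only [assignmentSize, hτ, card_prof, Ne, valOf_eq_zero valEnum (hf _)]
      exact ncard_fin_eq fun v => ¬f v = 0
    · rw [count_prof (by omega), ← ncard_fin_eq fun v => f v = i + 1]
      congr 1
      ext v
      rw [Set.mem_ofPred_eq, Set.mem_ofPred_eq, hτ, ← valOf_succ, eq_comm,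
        ← idxOf_eq_iff valEnum (hf _), idxOf_valOf valEnum (by omega), eq_comm]
  constructor
  · rintro ⟨τ, hτ, hp⟩
    have h := key τ (fun v => if h : v < I.numVars then idxOf valEnum (τ ⟨v, h⟩) else 0)
      (fun v => by split_ifs; exacts [idxOf_le _ _, Nat.zero_le _])
      (fun v => by simp [valOf_idxOf])
    refine ⟨_, ⟨fun v => ?_, fun v hv => ?_, h.1.1 hτ⟩, ?_⟩
    · split_ifs
      exacts [idxOf_le _ _, Nat.zero_le _]
    · exact dif_neg (by omega)
    · rwa [← h.2.1, ← h.2.2]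
  · rintro ⟨f, hf, hp⟩
    have h := key (fun v => valOf valEnum (f v)) f hf.le fun _ => rfl
    exact ⟨_, h.1.2 hf.ok, by rwa [h.2.1, h.2.2]⟩

/-- Every ordering of a multiset of at most `k` nonzero values occurs in `types d k`, so an
arbitrary ordering of the profile can be used. -/
theorem exists_type_iff {n k : ℕ} {A cs : List (ℕ × List ℕ)} (p : List ℕ → Bool)
    (q : Multiset ℕ → Prop) (hpq : ∀ t ∈ types d k, p t = true ↔ q t)
    (hq : ∀ s, q s → s.card ≤ k) :
    (∃ t ∈ (types d k).filter p, ∃ f, IsSol A cs d n f ∧ prof n f = t) ↔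
      ∃ f, IsSol A cs d n f ∧ q (prof n f) := by
  constructor
  · rintro ⟨t, ht, f, hf, hft⟩
    obtain ⟨ht, hpt⟩ := List.mem_filter.1 ht
    exact ⟨f, hf, by rw [hft]; exact (hpq t ht).1 hpt⟩
  · rintro ⟨f, hf, hqf⟩
    have ht : (prof n f).toList ∈ types d k := by
      refine mem_types.2 ⟨by simpa using hq _ hqf, fun a ha => ?_⟩
      obtain ⟨v, -, rfl, h0⟩ := mem_prof (Multiset.mem_toList.1 ha)
      exact mem_vals.2 ⟨Nat.pos_of_ne_zero h0, hf.le v⟩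
    refine ⟨_, List.mem_filter.2 ⟨ht, ?_⟩, f, hf, by simp⟩
    rw [hpq _ ht]
    simpa using hqf

/-! ### The two problems -/

theorem ParamProblem.IsFPT.of_fpt {P : ParamProblem} {ε : Type*} [Enc ε] {e : P.Inst → ε}
    {b : P.Inst → Bool} (h : Fpt (fun I => (P.param I, P.size I)) e b)
    (he : ∀ I, enc (e I) = P.encode I) (hb : ∀ I, b I = true ↔ P.Yes I) : P.IsFPT := by
  obtain ⟨p, F, c, hF, h⟩ := h
  refine ⟨p, F, c, hF.to_comp, fun I => ?_⟩
  obtain ⟨t, ht, hr⟩ := h I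
  refine ⟨enc (b I), t, he I ▸ hr, ht, ?_⟩
  rw [← hb]
  cases b I <;> simp [enc]

/-! ### Testing the cardinality constraint, and assembly. -/

/-- The number of occurrences of `i`, `i + 1`, … in `t` is given by the entries of `l`. -/
def hasCounts (t : List ℕ) (i : ℕ) (l : List ℕ) : Bool :=
  (l.foldl (fun s m => (s.1 && decide ((t.filter fun a => decide (a = s.2)).length = m), s.2 + 1))
    (true, i)).1

theorem hasCounts_eq_true (t : List ℕ) (i : ℕ) (l : List ℕ) :
    hasCounts t i l = true ↔ ∀ j : Fin l.length, t.count (i + j) = l.get j := by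
  suffices h : ∀ (b : Bool), (l.foldl (fun s m => (s.1 &&
      decide ((t.filter fun a => decide (a = s.2)).length = m), s.2 + 1)) (b, i)).1 = true ↔
      b = true ∧ ∀ j : Fin l.length, t.count (i + j) = l.get j by
    rw [hasCounts, h]; simp
  induction l generalizing i with
  | nil => simp
  | cons m l ih =>
    intro b
    have hc : (t.filter fun a => decide (a = i)).length = t.count i := by
      rw [List.count_eq_length_filter]
      rfl
    rw [List.foldl_cons, ih, hc]
    simp only [Bool.and_eq_true, decide_eq_true_eq, List.length_cons, Fin.forall_fin_succ,
      and_assoc, Fin.val_zero, add_zero, List.get_cons_zero, Fin.val_succ]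
    refine and_congr_right fun _ => and_congr_right fun _ => forall_congr' fun j => ?_
    rw [add_assoc, add_comm 1]
    rfl

/-- Both comparisons are driven by their bounded side: the count, at most the length of `t j`,
against an unbounded entry of `l j`, and a value at most `d` against the running index. -/
theorem Fpt.hasCounts {J : Type*} {μ : J → ℕ × ℕ} {ε : Type*} [Enc ε] {e : J → ε}
    {t l : J → List ℕ} (i d r : ℕ) (ht : Fpt μ e t) (hn : Bd μ fun j => (t j).length)
    (hd : ∀ j, ∀ a ∈ t j, a ≤ d) (hl : Fpt μ e l) (hr : ∀ j, (l j).length ≤ r) :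
    Fpt μ e (fun j => hasCounts (t j) i (l j)) := by
  refine Fpt.fst (Fpt.foldl (g := fun j s m =>
    (s.1 && decide (((t j).filter fun a => decide (a = s.2)).length = m), s.2 + 1)) noInv hl
    ((Bd.const r).mono hr) (.const (true, i)) (fun _ => trivial) (fun _ _ _ _ _ _ _ => trivial) ?_)
  refine (loopState.fst.and (Fpt.natEq (Fpt.length (Fpt.filter (h := fun (x : LoopIdx l noInv) a =>
    decide (a = x.1.2.1.2)) ht.inLoop (hn.reindex _) ?_) ((hn.reindex _).mono fun x =>
      List.length_filter_le _ _)) loopElem ((hn.reindex _).mono fun x =>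
      List.length_filter_le _ _))).pair loopState.snd.succ
  exact Fpt.natEq Fpt.id.fst Fpt.id.snd.snd.fst.snd ((Bd.const d).mono fun x => hd _ _ x.2)

end Language

theorem isFPT_OCSP {D : Type*} [Zero D] [Finite D] {Γ : Set (Rel D)} (hfin : Γ.Finite)
    (hzero : ∀ R ∈ Γ, R.ZeroValid) (hws : WeaklySeparable Γ) {relCode : Γ → ℕ}
    (hcode : Function.Injective relCode) {d : ℕ} (valEnum : Fin d ≃ {a : D // a ≠ 0}) :
    (OCSP Γ relCode).IsFPT := by
  obtain ⟨r, hr⟩ := (hfin.image Rel.arity).bddAbove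
  obtain ⟨A, hA⟩ := exists_list_allowed valEnum hfin relCode
  let e : OCSPInstance Γ → (ℕ × List (ℕ × List ℕ)) × ℕ := fun I =>
    ((I.numVars, I.toInstance.codes relCode), I.k)
  let T : OCSPInstance Γ → List (List ℕ) := fun I =>
    (types d I.k).filter fun t => decide (t.length = I.k)
  have hC := fptCSP_codes (relCode := relCode) (OCSPInstance.toInstance (Γ := Γ))
    OCSPInstance.k (e := e) (fun R hR => hr ⟨R, hR, rfl⟩) Fpt.id.fst Fpt.id.snd
  have hbT : Bd (fun I : OCSPInstance Γ => (I.k, I.toInstance.size))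
      fun I => (types d I.k).length :=
    ((BdK.const d).pow hC.bd_k).bd.mono fun I => length_types_le d I.k
  have hT : Fpt (fun I : OCSPInstance Γ => (I.k, I.toInstance.size)) e T := by
    have hbt : Bd (fun x : ElemIdx fun I : OCSPInstance Γ => types d I.k =>
        (x.1.1.k, x.1.1.toInstance.size)) fun x => x.1.2.length :=
      (hC.bd_k.bd.reindex _).mono fun x => (mem_types.1 x.2).1
    exact Fpt.filter (h := fun I t => decide (t.length = I.k)) (hC.fpt_k.types d hC.bd_k) hbT
      ((Fpt.id.fst.length hbt).natEq hC.fpt_k.inElem hbt)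
  refine .of_fpt (hC.solve A d hT (hbT.mono fun I => List.length_filter_le _ _)
    fun I t ht => (List.mem_filter.1 ht).1) (fun I => ?_) fun I => ?_
  · exact congrArg (Data.cons · _) (I.toInstance.enc_codes relCode)
  · rw [solve_eq_true (separable_codes valEnum hcode hzero hws I.toInstance A hA)
      fun t ht => (List.mem_filter.1 ht).1]
    rw [exists_type_iff _ (fun s => s.card = I.k) (fun t _ => by simp) fun s hs => hs.le]
    exact (exists_satisfies_iff valEnum hcode I.toInstance hA fun m _ => m = I.k).symm

theorem isFPT_CCSP {D : Type*} [Zero D] [Finite D] {Γ : Set (Rel D)} (hfin : Γ.Finite)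
    (hzero : ∀ R ∈ Γ, R.ZeroValid) (hws : WeaklySeparable Γ) {relCode : Γ → ℕ}
    (hcode : Function.Injective relCode) {d : ℕ} (valEnum : Fin d ≃ {a : D // a ≠ 0}) :
    (CCSP Γ relCode valEnum).IsFPT := by
  obtain ⟨r, hr⟩ := (hfin.image Rel.arity).bddAbove
  obtain ⟨A, hA⟩ := exists_list_allowed valEnum hfin relCode
  let π : CCSPInstance Γ → List ℕ := fun I => List.ofFn fun i => I.card (valEnum i)
  let e : CCSPInstance Γ → (ℕ × List (ℕ × List ℕ)) × ℕ × List ℕ := fun I =>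
    ((I.numVars, I.toInstance.codes relCode), I.k, π I)
  -- Counting starts at 1 because the nonzero value with index `i` has number `i + 1`.
  let T : CCSPInstance Γ → List (List ℕ) := fun I =>
    (types d I.k).filter fun t => decide (t.length = I.k) && hasCounts t 1 (π I)
  have hC := fptCSP_codes (relCode := relCode) (CCSPInstance.toInstance (Γ := Γ))
    CCSPInstance.k (e := e) (fun R hR => hr ⟨R, hR, rfl⟩) Fpt.id.fst Fpt.id.snd.fst
  have hbT : Bd (fun I : CCSPInstance Γ => (I.k, I.toInstance.size))
      fun I => (types d I.k).length :=
    ((BdK.const d).pow hC.bd_k).bd.mono fun I => length_types_le d I.k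
  have hT : Fpt (fun I : CCSPInstance Γ => (I.k, I.toInstance.size)) e T := by
    have hbt : Bd (fun x : ElemIdx fun I : CCSPInstance Γ => types d I.k =>
        (x.1.1.k, x.1.1.toInstance.size)) fun x => x.1.2.length :=
      (hC.bd_k.bd.reindex _).mono fun x => (mem_types.1 x.2).1
    exact Fpt.filter (h := fun I t => decide (t.length = I.k) && hasCounts t 1 (π I))
      (hC.fpt_k.types d hC.bd_k) hbT (((Fpt.id.fst.length hbt).natEq hC.fpt_k.inElem hbt).and
        (Fpt.hasCounts 1 d d Fpt.id.fst hbt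
          (fun x a ha => (mem_vals.1 ((mem_types.1 x.2).2 a ha)).2)
          Fpt.id.snd.snd.snd (fun x => (List.length_ofFn).le)))
  refine .of_fpt (hC.solve A d hT (hbT.mono fun I => List.length_filter_le _ _)
    fun I t ht => (List.mem_filter.1 ht).1) (fun I => ?_) fun I => ?_
  · have hπ : enc (π I) = .ofList (List.ofFn fun i => .ofNat (I.card (valEnum i))) := by
      change Data.ofList ((π I).map enc) = _
      rw [List.map_ofFn]
      rfl
    change Data.cons (enc (I.numVars, I.toInstance.codes relCode))
      (Data.cons (enc I.k) (enc (π I))) = _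
    rw [I.toInstance.enc_codes relCode, hπ]
    rfl
  · rw [solve_eq_true (separable_codes valEnum hcode hzero hws I.toInstance A hA)
      fun t ht => (List.mem_filter.1 ht).1]
    rw [exists_type_iff _ (fun s => s.card = I.k ∧
      ∀ i : Fin d, s.count ((i : ℕ) + 1) = I.card (valEnum i)) (fun t _ => ?_) fun s hs => hs.1.le]
    · have h := exists_satisfies_iff valEnum hcode I.toInstance hA fun m c =>
        m = I.k ∧ ∀ i : Fin d, c i = I.card (valEnum i)
      rw [← h]
      exact exists_congr fun τ => and_congr_right fun _ => and_congr_right fun _ =>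
        (valEnum.forall_congr_left (p := fun i => {v | τ v = (valEnum i).1}.ncard =
          I.card (valEnum i))).trans (by simp)
    · rw [Bool.and_eq_true, decide_eq_true_eq, hasCounts_eq_true, Multiset.coe_card]
      refine and_congr_right fun _ => ?_
      simp only [π, Multiset.coe_count]
      constructor
      · intro h i
        simpa [add_comm] using h ⟨i, by simp⟩
      · intro h i
        simpa [add_comm] using h ⟨i, by simpa using i.2⟩

end SizeCSP

theorem mainTheorem4 {D : Type*} [Zero D] [Finite D] (Γ : Set (SizeCSP.Rel D))
    (hfin : Γ.Finite) (hcc0 : SizeCSP.IsCC0Language Γ) (hws : SizeCSP.WeaklySeparable Γ)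
    (relCode : Γ → ℕ) (hcode : Function.Injective relCode)
    {d : ℕ} (valEnum : Fin d ≃ {a : D // a ≠ 0}) :
    (SizeCSP.CCSP Γ relCode valEnum).IsFPT ∧ (SizeCSP.OCSP Γ relCode).IsFPT := by
  exact ⟨SizeCSP.isFPT_CCSP hfin hcc0.1 hws hcode valEnum,
    SizeCSP.isFPT_OCSP hfin hcc0.1 hws hcode valEnum⟩
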